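/- Let $k_0>0$, $L_{\mathrm t}>0$, $d\in\mathbb R$, $\mathbf p_{\mathrm c}\in\mathbb R^3$, $\mathcal Z=[d/2,\,d/2+L_{\mathrm t}]$, $\mathcal D=\{(x,y)\in\mathbb R^2: x^2+y^2\le k_0^2\}$ and $\gamma(x,y)=\sqrt{k_0^2-x^2-y^2}$. Write $\mathbf k=[k_x,\gamma(k_x,k_z),k_z]^{\mathsf T}$ and $\boldsymbol\kappa=[\kappa_x,\gamma(\kappa_x,\kappa_z),\kappa_z]^{\mathsf T}$ for $(k_x,k_z),(\kappa_x,\kappa_z)\in\mathcal D$. Let $W$ be unit, zero-mean, circularly symmetric complex Gaussian white noise on $\mathcal D\times\mathcal D$, i.e. $\mathbb E\{W(\mathbf k,\boldsymbol\kappa)W^*(\mathbf k',\boldsymbol\kappa')\}=\delta(\mathbf k-\mathbf k')\delta(\boldsymbol\kappa-\boldsymbol\kappa')$, and let $$\hat h_{\mathrm c}(z)=\frac1{(2\pi)^2}\iiiint_{\mathcal D\times\mathcal D} e^{-\mathrm j\mathbf k^{\mathsf T}\mathbf p_{\mathrm c}}\,\frac{2\pi/k_0}{\sqrt{\gamma(k_x,k_z)\gamma(\kappa_x,\kappa_z)}}\,W(\mathbf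 k,\boldsymbol\kappa)\,e^{\mathrm j\kappa_z z}\,\mathrm d\mathbf k\,\mathrm d\boldsymbol\kappa ,\qquad z\in\mathcal Z,$$ be the channel field (in a jointly measurable version), with gain $g_{\mathrm c}=\int_{\mathcal Z}|\hat h_{\mathrm c}(z)|^2\,\mathrm dz$. Then: 1. $\hat h_{\mathrm c}$ is a zero-mean, circularly symmetric complex Gaussian field on $\mathcal Z$ with autocorrelation $R_{\mathrm c}(z,z')=\frac{\sin(k_0(z-z'))}{k_0(z-z')}$ (equal to $1$ for $z=z'$), and $g_{\mathrm c}<\infty$ almost surely. 2. The integral operator on $L^2(\mathcal Z)$ with kernel $R_{\mathrm c}$ has a complete eigensystem $(\lambda_n,\phi_n)_{n\ge1}$: $\lambda_1\ge\lambda_2\ge\cdots$, the $\phi_n$ are orthonormal in $L^2(\mathcal Z)$, $\int_{\mathcal Z}R_{\mathrm c}(z,z')\phi_n(z')\,\mathrm dz'=\lambda_n\phi_n(z)$ for every $z\in\mathcal Z$, and the operator vanishes on the orthogonal complement of $\{\phi_n\}$. For every such eigensystem all $\lambda_n$ are positive and $R_{\mathrm c}(z,z')=\sum_{n=1}^\infty\lambda_n\phi_n(z)\phi_n^*(z')$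 for all $z,z'\in\mathcal Z$. 3. For every such eigensystem and every sequence $(\Psi_n)_{n\ge1}$ of i.i.d. $\mathcal{CN}(0,1)$ random variables, on any probability space, one has the Karhunen–Loève expansion $$\hat h_{\mathrm c}(z)\overset{d}{=}\sum_{n=1}^\infty\sqrt{\lambda_n}\,\phi_n(z)\,\Psi_n ,$$ where the series converges in mean square for every $z\in\mathcal Z$ and equality means that all finite-dimensional distributions agree. Moreover $$g_{\mathrm c}\overset{d}{=}\sum_{n=1}^\infty\lambda_n|\Psi_n|^2 ,$$ where the series converges almost surely, and the $|\Psi_n|^2$ are i.i.d. $\mathsf{Exp}(1)$. Thus $g_{\mathrm c}$ is distributed as a weighted sum of infinitely many i.i.d. $\mathsf{Exp}(1)$ variables. -/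

import Mathlib

open MeasureTheory ProbabilityTheory Filter Topology
open scoped ENNReal NNReal ComplexConjugate

noncomputable section

/-- `X` is a zero-mean, circularly symmetric, complex Gaussian random field on the index set `T`
with autocorrelation `𝔼[X s * conj (X t)] = C s t`. -/
structure IsCircularGaussianField {Ω T : Type*} [MeasurableSpace Ω] (P : Measure Ω)
    (X : T → Ω → ℂ) (C : T → T → ℂ) : Prop where
  gaussian : IsGaussianProcess X P
  mean_zero : ∀ t, ∫ ω, X t ω ∂P = 0
  autocorr : ∀ s t, ∫ ω, X s ω * conj (X t ω) ∂P = C s t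
  pseudo_zero : ∀ s t, ∫ ω, X s ω * X t ω ∂P = 0

/-- `W` is unit complex Gaussian white noise with control measure `μ`: `W f` is the stochastic
integral `∫ f dW` of a square-integrable `f`, and the formal relation
`𝔼[W(x) W(x')^*] = δ(x - x')` reads `𝔼[W f * conj (W g)] = ∫ f * conj g ∂μ`.
(The values of `W` at functions that are not square-integrable play no role.) -/
def IsComplexWhiteNoise {Ω α : Type*} [MeasurableSpace Ω] [MeasurableSpace α] (P : Measure Ω)
    (μ : Measure α) (W : (α → ℂ) → Ω → ℂ) : Prop :=
  IsCircularGaussianField P (fun f : {f : α → ℂ // MemLp f 2 μ} => W f.1)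
    (fun f g => ∫ x, f.1 x * conj (g.1 x) ∂μ)

/-- The disc `{(x, z) | x² + z² ≤ k₀²}` of propagating wavenumbers. -/
def waveDisc (k₀ : ℝ) : Set (ℝ × ℝ) := {q | q.1 ^ 2 + q.2 ^ 2 ≤ k₀ ^ 2}

/-- `γ(x, z) = √(k₀² - x² - z²)`. -/
def gammaY (k₀ : ℝ) (q : ℝ × ℝ) : ℝ := Real.sqrt (k₀ ^ 2 - q.1 ^ 2 - q.2 ^ 2)

/-- The wave vector `[x, γ(x, z), z]`. -/
def waveVec (k₀ : ℝ) (q : ℝ × ℝ) : Fin 3 → ℝ := ![q.1, gammaY k₀ q, q.2]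

/-- Lebesgue measure on the product of the receive and the transmit wavenumber disc. -/
def waveMeasure (k₀ : ℝ) : Measure ((ℝ × ℝ) × (ℝ × ℝ)) :=
  (volume.restrict (waveDisc k₀)).prod (volume.restrict (waveDisc k₀))

/-- The function of `(k, κ)` which the white noise is integrated against in the isotropic
multipath response between the transmit point `t` and the user at `p`:
`(2π)⁻² e^{-j k·p} (A_s / √(γ(k) γ(κ))) e^{j κ·t}`, with `A_s = 2π / k₀`. -/
def channelKernel (k₀ : ℝ) (p t : Fin 3 → ℝ) (q : (ℝ × ℝ) × (ℝ × ℝ)) : ℂ :=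
  (((1 / (2 * Real.pi) ^ 2 : ℝ)) : ℂ)
    * Complex.exp (-Complex.I * ((dotProduct (waveVec k₀ q.1) p : ℝ) : ℂ))
    * (((2 * Real.pi / k₀) / Real.sqrt (gammaY k₀ q.1 * gammaY k₀ q.2) : ℝ) : ℂ)
    * Complex.exp (Complex.I * ((dotProduct (waveVec k₀ q.2) t : ℝ) : ℂ))

/-- The transmit aperture `[d/2, d/2 + L]` on the `z`-axis. -/
def aperture (d L : ℝ) : Set ℝ := Set.Icc (d / 2) (d / 2 + L)

/-- `h` is (a jointly measurable version of) the channel field `z ↦ h_c([0, 0, z])` on the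
aperture, driven by the white noise `W`. -/
structure IsChannelField {Ω : Type*} [MeasurableSpace Ω] (P : Measure Ω) (k₀ d L : ℝ)
    (p : Fin 3 → ℝ) (W : (((ℝ × ℝ) × (ℝ × ℝ)) → ℂ) → Ω → ℂ) (h : ℝ → Ω → ℂ) : Prop where
  aemeasurable : AEMeasurable (fun x : ℝ × Ω => h x.1 x.2)
    ((volume.restrict (aperture d L)).prod P)
  eq_noise : ∀ z ∈ aperture d L, h z =ᵐ[P] W (channelKernel k₀ p ![0, 0, z])

/-- The sinc kernel `sin (k₀ (z - z')) / (k₀ (z - z'))`, equal to `1` on the diagonal. -/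
def sincKernel (k₀ : ℝ) (z z' : ℝ) : ℂ := ((Real.sinc (k₀ * (z - z')) : ℝ) : ℂ)

/-- `(lam n, phi n)` is a complete eigensystem of the integral operator with kernel `R` on
`L²(S)`: the eigenvalues are nonincreasing, the eigenfunctions are orthonormal, and the operator
vanishes on their orthogonal complement (so that no nonzero eigenvalue is missed and each one is
repeated according to its multiplicity). -/
structure IsEigensystem (R : ℝ → ℝ → ℂ) (S : Set ℝ) (lam : ℕ → ℝ) (phi : ℕ → ℝ → ℂ) :
    Prop where
  antitone : Antitone lam
  memLp : ∀ n, MemLp (phi n) 2 (volume.restrict S)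
  orthonormal : ∀ n m, ∫ z in S, phi n z * conj (phi m z) = if n = m then 1 else 0
  eigen : ∀ n, ∀ z ∈ S, ∫ z' in S, R z z' * phi n z' = (lam n : ℂ) * phi n z
  complete : ∀ f : ℝ → ℂ, MemLp f 2 (volume.restrict S) →
    (∀ n, ∫ z in S, f z * conj (phi n z) = 0) →
    ∀ᵐ z ∂(volume.restrict S), ∫ z' in S, R z z' * f z' = 0

/-- The law `CN(0, 1)`: independent real and imaginary parts with law `N(0, 1/2)`. -/
def stdComplexGaussian : Measure ℂ :=
  ((gaussianReal 0 (1 / 2)).prod (gaussianReal 0 (1 / 2))).map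
    Complex.measurableEquivRealProd.symm

/-- Independent `CN(0, 1)` random variables. -/
def IsIIDComplexGaussian {Ω : Type*} [MeasurableSpace Ω] (P : Measure Ω) (Psi : ℕ → Ω → ℂ) :
    Prop :=
  (∀ n, HasLaw (Psi n) stdComplexGaussian P) ∧ iIndepFun Psi P

/-- Partial sums of the series `∑ n, √(lam n) * phi n z * Psi n`. -/
def klPartialSum {Ω : Type*} (lam : ℕ → ℝ) (phi : ℕ → ℝ → ℂ) (Psi : ℕ → Ω → ℂ)
    (N : ℕ) (z : ℝ) (ω : Ω) : ℂ :=
  ∑ n ∈ Finset.range N, ((Real.sqrt (lam n) : ℝ) : ℂ) * phi n z * Psi n ω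

/-- On `S` the series `∑ n, √(lam n) * phi n z * Psi n` converges in mean square at every point
to a random field with the same finite-dimensional distributions as `h`. -/
def HasKLExpansion {Ω Ω' : Type*} [MeasurableSpace Ω] [MeasurableSpace Ω'] (P : Measure Ω)
    (P' : Measure Ω') (S : Set ℝ) (h : ℝ → Ω → ℂ) (lam : ℕ → ℝ) (phi : ℕ → ℝ → ℂ)
    (Psi : ℕ → Ω' → ℂ) : Prop :=
  ∃ hbar : S → Ω' → ℂ,
    (∀ z : S, MemLp (hbar z) 2 P' ∧
      Tendsto (fun N => eLpNorm (fun ω => klPartialSum lam phi Psi N z ω - hbar z ω) 2 P')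
        atTop (𝓝 0)) ∧
    ∀ I : Finset S,
      IdentDistrib (fun ω (z : I) => h z.1 ω) (fun ω (z : I) => hbar z.1 ω) P P'

/-- The channel gain `∫ |h(z)|² dz` over the aperture `S`. -/
def channelGain {Ω : Type*} (S : Set ℝ) (h : ℝ → Ω → ℂ) (ω : Ω) : ℝ :=
  ∫ z in S, ‖h z ω‖ ^ 2

end

/-!
The function integrated against the noise is `channelKernel k₀ p ![0, 0, z] q = K q * e^{i κ_z z}`,
where `K` does not depend on `z`. The density `‖K‖ ^ 2` is proportional to
`1 / (γ (k) γ (κ))`, which makes the push-forward of the wavenumber measure under `q ↦ κ_z` the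
uniform probability measure on the band `[-k₀, k₀]` (`map_withDensity_channelKernel`; as for the
uniform measure on a sphere, a coordinate is uniformly distributed). Hence `F ↦ W (K * F (κ_z))` is
a Gaussian field indexed isometrically by the Hilbert space `H = L²` of the band (`bandNoise`), and
the channel field is its value at the plane wave `e z : t ↦ e^{i t z}`. The sinc kernel appears as
`⟪e z, e z'⟫`, the Fourier transform of the uniform measure.

The spectral theory goes through the sampling operator `B : H → L²([a, b])`, `(B v) z = ⟪e z, v⟫`.
Then `B B*` is the integral operator with the sinc kernel. It is compact because the plane waves are
uniform limits of polynomials in `z`, and both `B` and `B*` are injective because the Fourier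
integral of a function of bounded support is entire
(`ae_eq_zero_of_fourier_eq_zero_on_Ioo`). So the compact operator `B B*` has a complete sequence of
eigenvectors, no eigenvalue vanishes, and for each eigensystem the vectors
`w n = (lam n)^(-1/2) B* (phi n)` form a Hilbert basis of `H` with
`⟪e z, w n⟫ = (lam n)^(1/2) phi n z` (`IsEigensystem.exists_hilbertBasis`). Mercer's formula is
Parseval's identity for `⟪e z, e z'⟫` in this basis, and the expansion of `e z` in the basis built
from the conjugate eigensystem becomes, under the isometric field, the Karhunen–Loève expansion of
the channel with `Psi n` the value of the field at `w n`; these values are independent `CN(0, 1)`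
variables.

The mean-square error of the partial sums tends to `0` at every point of the aperture and is at most
`1`, so its integral over the aperture tends to `0`. Along a random subsequence the error in
`L²(aperture)` then vanishes almost surely, and since the partial sums have squared norm
`∑ n < N, lam n * ‖Psi n‖ ^ 2`, the gain is the sum of the series
(`IsChannelField.ae_lintegral_eq_tsum`). Both expansions are measurable functions of the sequence
`Psi`, so they carry over in law to every other sequence of independent `CN(0, 1)` variables.
-/

local notation "⟪" x "," y "⟫" => inner ℂ x y

/-! ### Uniqueness for Fourier integrals -/

/-- The Fourier–Laplace integral of a function of bounded support is entire. -/
lemma differentiable_integral_mul_cexp {μ : Measure ℝ} {f : ℝ → ℂ} (hf : Integrable f μ) {M : ℝ}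
    (hM : ∀ᵐ x ∂μ, |x| ≤ M) :
    Differentiable ℂ (fun w : ℂ => ∫ x, f x * Complex.exp (w * x) ∂μ) := by
  intro w
  refine (hasDerivAt_integral_of_dominated_loc_of_deriv_le
    (F' := fun w x => f x * (Complex.exp (w * x) * x))
    (bound := fun x => ‖f x‖ * (Real.exp ((‖w‖ + 1) * M) * M))
    (Metric.ball_mem_nhds w one_pos) ?_ ?_ ?_ ?_ ?_ ?_).2.differentiableAt
  · filter_upwards with w'
    exact hf.aestronglyMeasurable.mul (by fun_prop)
  · refine (hf.norm.mul_const (Real.exp (‖w‖ * M))).mono'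
      (hf.aestronglyMeasurable.mul (by fun_prop)) ?_
    filter_upwards [hM] with x hx
    rw [norm_mul]
    gcongr
    refine (Complex.norm_exp_le_exp_norm _).trans (Real.exp_le_exp.2 ?_)
    rw [norm_mul, Complex.norm_real]
    gcongr
    exact hx
  · exact hf.aestronglyMeasurable.mul (by fun_prop)
  · filter_upwards [hM] with x hx w' hw'
    rw [norm_mul, norm_mul, Complex.norm_real]
    have h1 : ‖w'‖ ≤ ‖w‖ + 1 := by
      have := norm_le_norm_add_norm_sub' w' w
      rw [Metric.mem_ball, dist_eq_norm] at hw'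
      linarith
    have hM0 : 0 ≤ M := (abs_nonneg x).trans hx
    gcongr
    · refine (Complex.norm_exp_le_exp_norm _).trans (Real.exp_le_exp.2 ?_)
      rw [norm_mul, Complex.norm_real]
      gcongr
      exact hx
    · exact hx
  · exact hf.norm.mul_const _
  · filter_upwards with x w' _
    refine HasDerivAt.const_mul _ ?_
    simpa using ((hasDerivAt_id w').mul_const (x : ℂ)).cexp

lemma integrable_mul_cexp_ofReal_mul_I {μ : Measure ℝ} {f : ℝ → ℂ} (hf : Integrable f μ) (t : ℝ) :
    Integrable (fun x : ℝ => f x * Complex.exp (t * x * Complex.I)) μ := by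
  refine hf.mul_bdd (c := 1) (by fun_prop) ?_
  filter_upwards with x
  rw [← Complex.ofReal_mul, Complex.norm_exp_ofReal_mul_I]

/-- The positive and the negative part of `g` are densities of finite measures with the same
characteristic function. -/
lemma ae_eq_zero_of_fourier_eq_zero_real {μ : Measure ℝ} {g : ℝ → ℝ}
    (hg : Integrable g μ)
    (h : ∀ t : ℝ, ∫ x, (g x : ℂ) * Complex.exp (t * x * Complex.I) ∂μ = 0) : g =ᵐ[μ] 0 := by
  have hcf : ∀ (s : ℝ → ℝ), Integrable s μ → (∀ x, 0 ≤ s x) → ∀ t : ℝ,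
      charFun (μ.withDensity (fun x => ENNReal.ofReal (s x))) t
        = ∫ x, (s x : ℂ) * Complex.exp (t * x * Complex.I) ∂μ := by
    intro s hs hs0 t
    rw [charFun_apply_real, integral_withDensity_eq_integral_toReal_smul₀
      hs.aemeasurable.ennreal_ofReal (by simp)]
    refine integral_congr_ae (Eventually.of_forall fun x => ?_)
    simp [ENNReal.toReal_ofReal (hs0 x)]
  have h1 := hg.pos_part
  have h2 := hg.neg_part
  have := isFiniteMeasure_withDensity_ofReal h1.2
  have := isFiniteMeasure_withDensity_ofReal h2.2
  have key : μ.withDensity (fun x => ENNReal.ofReal (max (g x) 0))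
      = μ.withDensity (fun x => ENNReal.ofReal (max (-g x) 0)) := by
    refine Measure.ext_of_charFun (funext fun t => ?_)
    rw [hcf _ h1 (fun x => le_max_right _ _), hcf _ h2 (fun x => le_max_right _ _), ← sub_eq_zero,
      ← integral_sub (by exact integrable_mul_cexp_ofReal_mul_I h1.ofReal t)
        (by exact integrable_mul_cexp_ofReal_mul_I h2.ofReal t), ← h t]
    refine integral_congr_ae (Eventually.of_forall fun x => ?_)
    simp only
    rw [← sub_mul, ← Complex.ofReal_sub, max_zero_sub_max_neg_zero_eq_self]
  have hne : ∫⁻ x, ENNReal.ofReal (max (g x) 0) ∂μ ≠ ∞ :=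
    (lintegral_ofReal_le_lintegral_enorm _).trans_lt h1.2 |>.ne
  rw [withDensity_eq_iff h1.aemeasurable.ennreal_ofReal h2.aemeasurable.ennreal_ofReal hne] at key
  filter_upwards [key] with x hx
  rw [ENNReal.ofReal_eq_ofReal_iff (le_max_right _ _) (le_max_right _ _)] at hx
  have := max_zero_sub_max_neg_zero_eq_self (g x)
  simp only [Pi.zero_apply]
  linarith

/-- An integrable function is determined by its Fourier integrals. The Fourier integrals of `conj f`
vanish along with those of `f`, which reduces the claim to real functions. -/
lemma ae_eq_zero_of_fourier_eq_zero {μ : Measure ℝ} {f : ℝ → ℂ} (hf : Integrable f μ)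
    (h : ∀ t : ℝ, ∫ x, f x * Complex.exp (t * x * Complex.I) ∂μ = 0) : f =ᵐ[μ] 0 := by
  have hconj : ∀ t : ℝ, ∫ x, conj (f x) * Complex.exp (t * x * Complex.I) ∂μ = 0 := by
    intro t
    have := congrArg conj (h (-t))
    rw [← integral_conj, map_zero] at this
    rw [← this]
    refine integral_congr_ae (Eventually.of_forall fun x => ?_)
    simp [← Complex.exp_conj]
  have hfc : Integrable (fun x => conj (f x)) μ :=
    (LinearIsometryEquiv.integrable_comp_iff Complex.conjLIE).2 hf
  have hre : (fun x => (f x).re) =ᵐ[μ] 0 := by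
    refine ae_eq_zero_of_fourier_eq_zero_real hf.re fun t => ?_
    have := integral_add (integrable_mul_cexp_ofReal_mul_I hf t)
      (integrable_mul_cexp_ofReal_mul_I hfc t)
    rw [h t, hconj t, add_zero] at this
    rw [← mul_right_inj' (two_ne_zero (α := ℂ)), mul_zero, ← this, ← integral_const_mul]
    refine integral_congr_ae (Eventually.of_forall fun x => ?_)
    simp only
    rw [← add_mul, Complex.add_conj]
    push_cast
    ring
  have him : (fun x => (f x).im) =ᵐ[μ] 0 := by
    refine ae_eq_zero_of_fourier_eq_zero_real hf.im fun t => ?_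
    have := integral_sub (integrable_mul_cexp_ofReal_mul_I hf t)
      (integrable_mul_cexp_ofReal_mul_I hfc t)
    rw [h t, hconj t, sub_zero] at this
    rw [← mul_right_inj' (mul_ne_zero (two_ne_zero (α := ℂ)) Complex.I_ne_zero), mul_zero, ← this,
      ← integral_const_mul]
    refine integral_congr_ae (Eventually.of_forall fun x => ?_)
    simp only
    rw [← sub_mul, Complex.sub_conj]
    push_cast
    ring
  filter_upwards [hre, him] with x h1 h2
  exact Complex.ext h1 h2

/-- For a measure of bounded support, vanishing of the Fourier integral on an interval is enough, by
the identity theorem for entire functions. -/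
theorem ae_eq_zero_of_fourier_eq_zero_on_Ioo {μ : Measure ℝ} {f : ℝ → ℂ} (hf : Integrable f μ)
    {M : ℝ} (hM : ∀ᵐ x ∂μ, |x| ≤ M) {a b : ℝ} (hab : a < b)
    (h : ∀ t ∈ Set.Ioo a b, ∫ x, f x * Complex.exp (t * x * Complex.I) ∂μ = 0) : f =ᵐ[μ] 0 := by
  have hd := differentiable_integral_mul_cexp hf hM
  have han : AnalyticOnNhd ℂ (fun w : ℂ => ∫ x, f x * Complex.exp (w * Complex.I * x) ∂μ)
      Set.univ := by
    refine DifferentiableOn.analyticOnNhd (Differentiable.differentiableOn ?_) isOpen_univ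
    exact hd.comp (differentiable_id.mul_const Complex.I)
  have hz : (fun w : ℂ => ∫ x, f x * Complex.exp (w * Complex.I * x) ∂μ) = fun _ => 0 := by
    obtain ⟨c, hac, hcb⟩ := exists_between hab
    refine han.eq_of_frequently_eq analyticOnNhd_const (z₀ := (c : ℂ)) ?_
    have hev : ∀ᶠ t : ℝ in 𝓝[≠] c,
        (∫ x, f x * Complex.exp ((t : ℂ) * Complex.I * x) ∂μ) = 0 := by
      filter_upwards [nhdsWithin_le_nhds (Ioo_mem_nhds hac hcb)] with t ht
      rw [← h t ht]
      refine integral_congr_ae (Eventually.of_forall fun x => ?_)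
      simp only
      ring_nf
    have ht : Tendsto (fun t : ℝ => (t : ℂ)) (𝓝[≠] c) (𝓝[≠] (c : ℂ)) := by
      refine tendsto_nhdsWithin_iff.2 ⟨?_, ?_⟩
      · exact (Complex.continuous_ofReal.tendsto c).mono_left nhdsWithin_le_nhds
      · filter_upwards [self_mem_nhdsWithin] with t ht
        simpa using ht
    exact ht.frequently hev.frequently
  refine ae_eq_zero_of_fourier_eq_zero hf fun t => ?_
  rw [← congrFun hz t]
  refine integral_congr_ae (Eventually.of_forall fun x => ?_)
  simp only
  ring_nf

/-! ### Eigenvectors of positive compact operators -/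

section Spectral

variable {E : Type*} [NormedAddCommGroup E] [InnerProductSpace ℂ E] [CompleteSpace E]

/-- The norm of a positive compact operator is an eigenvalue: it equals the spectral radius, some
spectral value attains it, and nonzero spectral values of compact operators are eigenvalues. -/
lemma exists_unit_eigenvector_norm [Nontrivial E] {T : E →L[ℂ] E} (hc : IsCompactOperator T)
    (hp : T.IsPositive) : ∃ x : E, ‖x‖ = 1 ∧ T x = ((‖T‖ : ℝ) : ℂ) • x := by
  by_cases h0 : T = 0
  · obtain ⟨x, hx⟩ := exists_norm_eq E zero_le_one
    exact ⟨x, hx, by simp [h0]⟩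
  obtain ⟨k, hk, hkn⟩ := spectrum.exists_nnnorm_eq_spectralRadius T
  rw [T.spectralRadius_eq_nnnorm hp.isSelfAdjoint, ENNReal.coe_inj] at hkn
  have hkn' : ‖k‖ = ‖T‖ := congrArg NNReal.toReal hkn
  have hk0 : k ≠ 0 := by
    rw [← norm_ne_zero_iff, hkn']
    exact norm_ne_zero_iff.2 h0
  have hev := (hc.hasEigenvalue_iff_mem_spectrum hk0).2 hk
  have hkr : k = ((k.re : ℝ) : ℂ) :=
    (Complex.conj_eq_iff_real.1 (hp.isSymmetric.conj_eigenvalue_eq_self hev)).elim fun r hr => by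
      simp [hr]
  have hk1 : 0 ≤ k.re := by
    refine eigenvalue_nonneg_of_nonneg (𝕜 := ℂ) (T := (T : E →ₗ[ℂ] E)) (μ := k.re) ?_ fun x =>
      hp.re_inner_nonneg_right x
    simpa [← hkr] using! hev
  have hkT : k = ((‖T‖ : ℝ) : ℂ) := by
    rw [hkr, Complex.norm_real, Real.norm_of_nonneg hk1] at hkn'
    rw [← hkn', ← hkr]
  obtain ⟨v, hv⟩ := hev.exists_hasEigenvector
  have hv0 : ‖v‖ ≠ 0 := norm_ne_zero_iff.2 hv.2
  refine ⟨((‖v‖⁻¹ : ℝ) : ℂ) • v, ?_, ?_⟩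
  · rw [norm_smul, Complex.norm_real, norm_inv, norm_norm, inv_mul_cancel₀ hv0]
  · have := hv.apply_eq_smul
    rw [map_smul, ← hkT]
    simp only [ContinuousLinearMap.coe_coe] at this
    rw [this, smul_comm]

/-- A unit eigenvector of largest eigenvalue on the orthogonal complement of an invariant
subspace. -/
lemma exists_unit_eigenvector_orthogonal {T : E →L[ℂ] E} (hc : IsCompactOperator T)
    (hp : T.IsPositive) (V : Submodule ℂ E) (hV : Vᗮ ≠ ⊥) (hinv : ∀ v ∈ V, T v ∈ V) :
    ∃ (x : E) (r : ℝ), x ∈ Vᗮ ∧ ‖x‖ = 1 ∧ 0 ≤ r ∧ T x = (r : ℂ) • x ∧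
      ∀ y ∈ Vᗮ, ‖T y‖ ≤ r * ‖y‖ := by
  have hinv' : ∀ v ∈ Vᗮ, T v ∈ Vᗮ := by
    intro v hv u hu
    rw [← hp.inner_left_eq_inner_right]
    exact hv _ (hinv u hu)
  have hnt : Nontrivial Vᗮ := Submodule.nontrivial_iff_ne_bot.2 hV
  let S : Vᗮ →L[ℂ] Vᗮ := T.restrict hinv'
  have hSc : IsCompactOperator S := hc.restrict' hinv'
  have hSp : S.IsPositive :=
    ⟨hp.isSymmetric.restrict_invariant hinv', fun x => hp.re_inner_nonneg_left (x : E)⟩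
  obtain ⟨x, hx, hxS⟩ := exists_unit_eigenvector_norm hSc hSp
  refine ⟨x, ‖S‖, x.2, hx, S.opNorm_nonneg, congrArg Subtype.val hxS, fun y hy => ?_⟩
  exact S.le_opNorm ⟨y, hy⟩

/-- The spectral theorem in sequence form, obtained by choosing at each step a unit eigenvector of
largest eigenvalue orthogonal to all earlier ones. In infinite dimension the choice never stops. -/
theorem exists_eigenvector_sequence (hE : ¬ FiniteDimensional ℂ E) {T : E →L[ℂ] E}
    (hc : IsCompactOperator T) (hp : T.IsPositive) :
    ∃ (r : ℕ → ℝ) (x : ℕ → E), Antitone r ∧ (∀ n, 0 ≤ r n) ∧ Orthonormal ℂ x ∧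
      (∀ n, T (x n) = (r n : ℂ) • x n) ∧ ∀ y, (∀ n, ⟪x n, y⟫ = 0) → T y = 0 := by
  classical
  -- `F V` is the eigenvector chosen orthogonally to `V`, and `r V` its eigenvalue.
  let Good : Submodule ℂ E → Prop := fun V => FiniteDimensional ℂ V ∧ ∀ v ∈ V, T v ∈ V
  have hex : ∀ V : Submodule ℂ E, ∃ (x : E) (r : ℝ), Good V → x ∈ Vᗮ ∧ ‖x‖ = 1 ∧ 0 ≤ r ∧
      T x = (r : ℂ) • x ∧ ∀ y ∈ Vᗮ, ‖T y‖ ≤ r * ‖y‖ := by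
    intro V
    by_cases hV : Good V
    · have := hV.1
      have hne : Vᗮ ≠ ⊥ := by
        intro hbot
        rw [Submodule.orthogonal_eq_bot_iff] at hbot
        subst hbot
        exact hE (Module.Finite.equiv (Submodule.topEquiv (R := ℂ) (M := E)))
      obtain ⟨x, r, h⟩ := exists_unit_eigenvector_orthogonal hc hp V hne hV.2
      exact ⟨x, r, fun _ => h⟩
    · exact ⟨0, 0, fun h => absurd h hV⟩
  choose F r hF using hex
  let V : ℕ → Submodule ℂ E := fun n => Nat.rec ⊥ (fun _ W => W ⊔ Submodule.span ℂ {F W}) n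
  have hVs : ∀ n, V (n + 1) = V n ⊔ Submodule.span ℂ {F (V n)} := fun n => rfl
  have hgood : ∀ n, Good (V n) := by
    intro n
    induction n with
    | zero =>
      refine ⟨inferInstanceAs (FiniteDimensional ℂ (⊥ : Submodule ℂ E)), fun v hv => ?_⟩
      have hv0 : v = 0 := hv
      simp [hv0]
    | succ n ih =>
      obtain ⟨-, -, -, hT, -⟩ := hF (V n) ih
      have := ih.1
      refine ⟨by rw [hVs]; infer_instance, fun v hv => ?_⟩
      rw [hVs] at hv ⊢
      obtain ⟨u, hu, w, hw, rfl⟩ := Submodule.mem_sup.1 hv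
      obtain ⟨c, rfl⟩ := Submodule.mem_span_singleton.1 hw
      rw [map_add, map_smul, hT]
      refine Submodule.add_mem_sup (ih.2 u hu) ?_
      exact Submodule.smul_mem _ _ (Submodule.smul_mem _ _ (Submodule.mem_span_singleton_self _))
  have hmono : Monotone V := monotone_nat_of_le_succ fun n => by rw [hVs]; exact le_sup_left
  have hmem : ∀ {m n}, m < n → F (V m) ∈ V n := fun {m n} h =>
    hmono h (by rw [hVs]; exact Submodule.mem_sup_right (Submodule.mem_span_singleton_self _))
  have hP := fun n => hF (V n) (hgood n)
  have hanti : Antitone fun n => r (V n) := by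
    refine antitone_nat_of_succ_le fun n => ?_
    have h1 := (hP n).2.2.2.2 _ (Submodule.orthogonal_le (hmono n.le_succ) (hP (n + 1)).1)
    rw [(hP (n + 1)).2.2.2.1, norm_smul, (hP (n + 1)).2.1, Complex.norm_real,
      Real.norm_of_nonneg (hP (n + 1)).2.2.1, mul_one, mul_one] at h1
    exact h1
  have horth : Orthonormal ℂ fun n => F (V n) := by
    refine ⟨fun n => (hP n).2.1, fun m n hmn => ?_⟩
    rcases lt_or_gt_of_ne hmn with h | h
    · exact (hP n).1 _ (hmem h)
    · rw [← inner_conj_symm, (hP m).1 _ (hmem h), map_zero]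
  refine ⟨fun n => r (V n), fun n => F (V n), hanti, fun n => (hP n).2.2.1, horth,
    fun n => (hP n).2.2.2.1, fun y hy => ?_⟩
  have hyV : ∀ n, y ∈ (V n)ᗮ := by
    intro n
    induction n with
    | zero =>
      intro u hu
      have hu0 : u = 0 := hu
      simp [hu0]
    | succ n ih =>
      rw [hVs, ← Submodule.inf_orthogonal]
      exact Submodule.mem_inf.2
        ⟨ih, (Submodule.mem_orthogonal_singleton_iff_inner_right).2 (hy n)⟩
  have hTy : ∀ n, ‖T y‖ ≤ r (V n) * ‖y‖ := fun n => (hP n).2.2.2.2 y (hyV n)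
  -- Otherwise the eigenvalues stay above some `ε`, and `T (F (V n))` is an `ε`-separated sequence
  -- in a compact set.
  by_contra hne
  have hypos : 0 < ‖T y‖ := norm_pos_iff.2 hne
  have hy0 : 0 < ‖y‖ := by
    refine norm_pos_iff.2 fun h => hne (by simp [h])
  set ε := ‖T y‖ / ‖y‖
  have hε : 0 < ε := by positivity
  have hrε : ∀ n, ε ≤ r (V n) := fun n => by
    rw [div_le_iff₀ hy0]
    exact hTy n
  obtain ⟨K, hK, hKT⟩ := hc.image_closedBall_subset_compact 1
  obtain ⟨a, -, g, hg, ha⟩ := hK.tendsto_subseq (x := fun n => T (F (V n))) fun n =>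
    hKT ⟨_, by simp [(hP n).2.1], rfl⟩
  obtain ⟨N, hN⟩ := Metric.cauchySeq_iff.1 ha.cauchySeq ε hε
  have hd := hN N le_rfl (N + 1) N.le_succ
  have hlt : g N < g (N + 1) := hg N.lt_succ_self
  simp only [Function.comp_apply, dist_eq_norm] at hd
  rw [(hP _).2.2.2.1, (hP _).2.2.2.1] at hd
  have hin : ⟪(r (V (g N)) : ℂ) • F (V (g N)),
      (r (V (g (N + 1))) : ℂ) • F (V (g (N + 1)))⟫ = 0 := by
    rw [inner_smul_left, inner_smul_right, horth.2 hlt.ne]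
    simp
  have hp2 : ‖(r (V (g N)) : ℂ) • F (V (g N)) - (r (V (g (N + 1))) : ℂ) • F (V (g (N + 1)))‖ ^ 2
      = r (V (g N)) ^ 2 + r (V (g (N + 1))) ^ 2 := by
    rw [@norm_sub_sq ℂ, hin]
    simp [norm_smul, (hP _).2.1]
  have h3 := hrε (g N)
  nlinarith [norm_nonneg ((r (V (g N)) : ℂ) • F (V (g N))
    - (r (V (g (N + 1))) : ℂ) • F (V (g (N + 1)))), sq_nonneg (r (V (g (N + 1))))]

end Spectral

/-! ### Sampling operators -/

section Sampling

variable {H : Type*} [NormedAddCommGroup H] [InnerProductSpace ℂ H]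

lemma Continuous.memLp_restrict_Icc {f : ℝ → ℂ} (hf : Continuous f) (a b : ℝ) (p : ℝ≥0∞) :
    MemLp f p (volume.restrict (Set.Icc a b)) := by
  obtain ⟨C, hC⟩ := isCompact_Icc.exists_bound_of_continuousOn (hf.continuousOn (s := Set.Icc a b))
  refine MemLp.of_bound hf.aestronglyMeasurable C ?_
  exact (ae_restrict_iff' measurableSet_Icc).2 (Eventually.of_forall hC)

lemma memLp_inner_curve {e : ℝ → H} (he : Continuous e) (a b : ℝ) (v : H) :
    MemLp (fun z => ⟪e z, v⟫) 2 (volume.restrict (Set.Icc a b)) :=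
  Continuous.memLp_restrict_Icc (he.inner continuous_const) a b 2

/-- The operator `v ↦ (z ↦ ⟪e z, v⟫)` from `H` to `L²([a, b])` attached to a continuous curve `e`
in the Hilbert space `H`. -/
noncomputable def samplingOp (e : ℝ → H) (he : Continuous e) (a b : ℝ) :
    H →L[ℂ] Lp ℂ 2 (volume.restrict (Set.Icc a b)) :=
  LinearMap.mkContinuousOfExistsBound
    { toFun := fun v => (memLp_inner_curve he a b v).toLp
      map_add' := fun v w => by
        rw [← MemLp.toLp_add]
        congr 1
        ext z
        simp
      map_smul' := fun c v => by
        rw [RingHom.id_apply, ← MemLp.toLp_const_smul]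
        congr 1
        ext z
        simp }
    (by
      obtain ⟨C, hC⟩ := isCompact_Icc.exists_bound_of_continuousOn
        (he.continuousOn (s := Set.Icc a b))
      refine ⟨(measureUnivNNReal (volume.restrict (Set.Icc a b)) : ℝ) ^ (2 : ℝ≥0∞).toReal⁻¹ * |C|,
        fun v => ?_⟩
      rw [mul_assoc]
      refine Lp.norm_le_of_ae_bound (by positivity) ?_
      refine (MemLp.coeFn_toLp (memLp_inner_curve he a b v)).mp ?_
      refine (ae_restrict_iff' measurableSet_Icc).2 (Eventually.of_forall fun z hz h => ?_)
      rw [LinearMap.coe_mk, AddHom.coe_mk, h]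
      refine (norm_inner_le_norm _ _).trans ?_
      gcongr
      exact (hC z hz).trans (le_abs_self C))

lemma coeFn_samplingOp (e : ℝ → H) (he : Continuous e) (a b : ℝ) (v : H) :
    samplingOp e he a b v =ᵐ[volume.restrict (Set.Icc a b)] fun z => ⟪e z, v⟫ :=
  MemLp.coeFn_toLp (memLp_inner_curve he a b v)

/-- If `e` is, uniformly on `[a, b]`, a limit of polynomials with coefficients in `H`, then its
sampling operator is a norm limit of operators of finite rank. -/
lemma isCompactOperator_samplingOp (e : ℝ → H) (he : Continuous e) (a b : ℝ) (g : ℕ → H)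
    (δ : ℕ → ℝ) (hδ : Tendsto δ atTop (𝓝 0))
    (h : ∀ᶠ N in atTop, ∀ z ∈ Set.Icc a b,
      ‖e z - ∑ n ∈ Finset.range N, ((z : ℂ) ^ n) • g n‖ ≤ δ N) :
    IsCompactOperator (samplingOp e he a b) := by
  have hm : ∀ n : ℕ, MemLp (fun z : ℝ => (z : ℂ) ^ n) 2 (volume.restrict (Set.Icc a b)) := fun n =>
    Continuous.memLp_restrict_Icc (by fun_prop) a b 2
  let F : ℕ → H →L[ℂ] Lp ℂ 2 (volume.restrict (Set.Icc a b)) := fun N =>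
    ∑ n ∈ Finset.range N, (innerSL ℂ (g n)).smulRight ((hm n).toLp)
  have hF : ∀ N v, F N v =ᵐ[volume.restrict (Set.Icc a b)]
      fun z => ⟪∑ n ∈ Finset.range N, ((z : ℂ) ^ n) • g n, v⟫ := by
    intro N v
    induction N with
    | zero =>
      simp only [F, Finset.range_zero, Finset.sum_empty, inner_zero_left]
      exact Lp.coeFn_zero _ _ _
    | succ N ih =>
      have h1 : F (N + 1) v = F N v + ⟪g N, v⟫ • (hm N).toLp := by
        simp [F, Finset.sum_range_succ]
      rw [h1]
      filter_upwards [ih, Lp.coeFn_add (F N v) (⟪g N, v⟫ • (hm N).toLp),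
        Lp.coeFn_smul (⟪g N, v⟫) ((hm N).toLp), (hm N).coeFn_toLp] with z h2 h3 h4 h5
      rw [h3, Pi.add_apply, h2, h4, Pi.smul_apply, h5, Finset.sum_range_succ, inner_add_left,
        inner_smul_left, map_pow, Complex.conj_ofReal, smul_eq_mul, mul_comm]
  have hFc : ∀ N, IsCompactOperator (F N) := by
    intro N
    induction N with
    | zero =>
      simp only [F, Finset.range_zero, Finset.sum_empty]
      exact isCompactOperator_zero
    | succ N ih =>
      have h1 : F (N + 1) = F N + (innerSL ℂ (g N)).smulRight ((hm N).toLp) := by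
        simp [F, Finset.sum_range_succ]
      rw [h1]
      refine ih.add ?_
      have h2 : IsCompactOperator (innerSL ℂ (g N)) :=
        isCompactOperator_of_locallyCompactSpace_dom _
      exact h2.clm_comp (ContinuousLinearMap.toSpanSingleton ℂ (hm N).toLp)
  refine isCompactOperator_of_tendsto (l := atTop) (F := F) ?_ (Eventually.of_forall hFc)
  set c : ℝ := (measureUnivNNReal (volume.restrict (Set.Icc a b)) : ℝ) ^ (2 : ℝ≥0∞).toReal⁻¹
  have hc : 0 ≤ c := by positivity
  rw [tendsto_iff_norm_sub_tendsto_zero]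
  refine squeeze_zero' (Eventually.of_forall fun _ => norm_nonneg _) ?_
    (by simpa using (hδ.abs).const_mul c)
  filter_upwards [h] with N hN
  refine ContinuousLinearMap.opNorm_le_bound _ (by positivity) fun v => ?_
  rw [mul_assoc, sub_apply, norm_sub_rev]
  refine Lp.norm_le_of_ae_bound (by positivity) ?_
  filter_upwards [Lp.coeFn_sub (samplingOp e he a b v) (F N v), hF N v, coeFn_samplingOp e he a b v,
    self_mem_ae_restrict (measurableSet_Icc (a := a) (b := b))] with z h3 h1 h2 hz
  rw [h3, Pi.sub_apply, h1, h2, ← inner_sub_left]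
  refine (norm_inner_le_norm _ _).trans ?_
  gcongr
  exact (hN z hz).trans (le_abs_self _)

variable [CompleteSpace H]

/-- For the sampling operator `B`, this says that `B B*` is the integral operator with kernel
`⟪e z, e z'⟫`. -/
lemma inner_adjoint_samplingOp (e : ℝ → H) (he : Continuous e) (a b : ℝ)
    (f : Lp ℂ 2 (volume.restrict (Set.Icc a b))) (z : ℝ) :
    ⟪e z, (samplingOp e he a b).adjoint f⟫ = ∫ z' in Set.Icc a b, ⟪e z, e z'⟫ * f z' := by
  rw [ContinuousLinearMap.adjoint_inner_right, L2.inner_def]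
  refine integral_congr_ae ?_
  filter_upwards [coeFn_samplingOp e he a b (e z)] with z' h
  rw [h, RCLike.inner_apply, inner_conj_symm, mul_comm]

end Sampling

/-! ### Plane waves in `L²` of the band -/

/-- The uniform probability measure on the band `[-k₀, k₀]` (for `0 < k₀`). -/
noncomputable def bandMeasure (k₀ : ℝ) : Measure ℝ :=
  ENNReal.ofReal (2 * k₀)⁻¹ • volume.restrict (Set.Icc (-k₀) k₀)

instance isFiniteMeasure_bandMeasure (k₀ : ℝ) : IsFiniteMeasure (bandMeasure k₀) :=
  Measure.smul_finite _ ENNReal.ofReal_ne_top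

lemma ae_bandMeasure_abs_le (k₀ : ℝ) : ∀ᵐ t ∂(bandMeasure k₀), |t| ≤ k₀ := by
  refine Measure.ae_smul_measure ?_ _
  filter_upwards [self_mem_ae_restrict (measurableSet_Icc (a := -k₀) (b := k₀))] with t ht
  exact abs_le.2 ht

lemma integral_bandMeasure {k₀ : ℝ} (hk : 0 < k₀) (f : ℝ → ℂ) :
    ∫ t, f t ∂(bandMeasure k₀) = ((2 * k₀)⁻¹ : ℝ) * ∫ t in (-k₀)..k₀, f t := by
  rw [bandMeasure, integral_smul_measure, ENNReal.toReal_ofReal (by positivity),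
    intervalIntegral.integral_of_le (by linarith), integral_Icc_eq_integral_Ioc, Complex.real_smul]

lemma integral_cexp_bandMeasure {k₀ : ℝ} (hk : 0 < k₀) (u : ℝ) :
    ∫ t, Complex.exp (t * u * Complex.I) ∂(bandMeasure k₀) = (Real.sinc (k₀ * u) : ℝ) := by
  rw [integral_bandMeasure hk]
  rcases eq_or_ne u 0 with rfl | hu
  · simp only [Complex.ofReal_zero, mul_zero, zero_mul, Complex.exp_zero, Real.sinc_zero]
    rw [intervalIntegral.integral_const, Complex.real_smul, mul_one, ← Complex.ofReal_mul]
    congr 1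
    field_simp
    ring
  · have h1 := intervalIntegral.integral_comp_mul_right (a := -k₀) (b := k₀)
      (fun t : ℝ => Complex.exp (t * Complex.I)) hu
    simp only [Complex.ofReal_mul, neg_mul] at h1
    rw [h1, integral_exp_mul_I_eq_sinc, Complex.real_smul]
    push_cast
    have : (u : ℂ) ≠ 0 := by exact_mod_cast hu
    have : (k₀ : ℂ) ≠ 0 := by exact_mod_cast hk.ne'
    field_simp

lemma memLp_cexp_bandMeasure (k₀ z : ℝ) :
    MemLp (fun t : ℝ => Complex.exp (t * z * Complex.I)) 2 (bandMeasure k₀) := by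
  refine MemLp.of_bound (by fun_prop) 1 (Eventually.of_forall fun t => ?_)
  rw [← Complex.ofReal_mul, Complex.norm_exp_ofReal_mul_I]

/-- The plane wave `t ↦ e^{i t z}` as an element of `L²` of the band. -/
noncomputable def planeWave (k₀ z : ℝ) : Lp ℂ 2 (bandMeasure k₀) :=
  (memLp_cexp_bandMeasure k₀ z).toLp

lemma coeFn_planeWave (k₀ z : ℝ) :
    planeWave k₀ z =ᵐ[bandMeasure k₀] fun t : ℝ => Complex.exp (t * z * Complex.I) :=
  MemLp.coeFn_toLp (memLp_cexp_bandMeasure k₀ z)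

lemma inner_planeWave_left (k₀ z : ℝ) (v : Lp ℂ 2 (bandMeasure k₀)) :
    ⟪planeWave k₀ z, v⟫
      = ∫ t, v t * Complex.exp ((-z : ℝ) * t * Complex.I) ∂(bandMeasure k₀) := by
  rw [L2.inner_def]
  refine integral_congr_ae ?_
  filter_upwards [coeFn_planeWave k₀ z] with t ht
  rw [ht, RCLike.inner_apply, ← Complex.exp_conj]
  congr 2
  simp
  ring

lemma inner_planeWave_planeWave {k₀ : ℝ} (hk : 0 < k₀) (z z' : ℝ) :
    ⟪planeWave k₀ z, planeWave k₀ z'⟫ = sincKernel k₀ z z' := by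
  have h1 : sincKernel k₀ z z' = ((Real.sinc (k₀ * (z' - z)) : ℝ) : ℂ) := by
    rw [sincKernel, ← Real.sinc_neg]
    congr 2
    ring
  rw [inner_planeWave_left, h1, ← integral_cexp_bandMeasure hk]
  refine integral_congr_ae ?_
  filter_upwards [coeFn_planeWave k₀ z'] with t ht
  rw [ht, ← Complex.exp_add]
  congr 1
  push_cast
  ring

lemma norm_planeWave {k₀ : ℝ} (hk : 0 < k₀) (z : ℝ) : ‖planeWave k₀ z‖ = 1 := by
  have h := inner_planeWave_planeWave hk z z
  rw [inner_self_eq_norm_sq_to_K, sincKernel, sub_self, mul_zero, Real.sinc_zero] at h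
  have h2 : ‖planeWave k₀ z‖ ^ 2 = 1 := Complex.ofReal_injective (by simpa using h)
  exact (pow_eq_one_iff_of_nonneg (norm_nonneg _) two_ne_zero).1 h2

lemma continuous_planeWave {k₀ : ℝ} (hk : 0 < k₀) : Continuous (planeWave k₀) := by
  rw [continuous_iff_continuousAt]
  intro z
  rw [ContinuousAt, tendsto_iff_norm_sub_tendsto_zero]
  have h : ∀ y, ‖planeWave k₀ y - planeWave k₀ z‖
      = Real.sqrt (2 - 2 * Real.sinc (k₀ * (y - z))) := by
    intro y
    rw [← Real.sqrt_sq (norm_nonneg _), @norm_sub_sq ℂ, inner_planeWave_planeWave hk,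
      norm_planeWave hk, norm_planeWave hk, sincKernel, RCLike.re_eq_complex_re, Complex.ofReal_re]
    congr 1
    ring
  simp_rw [h]
  have hc : Continuous fun y => Real.sqrt (2 - 2 * Real.sinc (k₀ * (y - z))) := by
    have := Real.continuous_sinc
    fun_prop
  simpa using hc.tendsto z

/-- Plane waves at the points of a nondegenerate interval are total in `L²` of the band. -/
lemma eq_zero_of_inner_planeWave_eq_zero {k₀ : ℝ} (hk : 0 < k₀) {a b : ℝ} (hab : a < b)
    {v : Lp ℂ 2 (bandMeasure k₀)}
    (h : ∀ᵐ z ∂(volume.restrict (Set.Icc a b)), ⟪planeWave k₀ z, v⟫ = 0) : v = 0 := by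
  have hc : Continuous fun z => ⟪planeWave k₀ z, v⟫ :=
    (continuous_planeWave hk).inner continuous_const
  have h0 := Measure.eqOn_Icc_of_ae_eq volume hab.ne (g := fun _ => (0 : ℂ)) h hc.continuousOn
    continuousOn_const
  refine Lp.eq_zero_iff_ae_eq_zero.2 (ae_eq_zero_of_fourier_eq_zero_on_Ioo
    ((Lp.memLp v).integrable (by norm_num)) (ae_bandMeasure_abs_le k₀) (neg_lt_neg hab)
    fun t ht => ?_)
  have h1 : ⟪planeWave k₀ (-t), v⟫ = 0 := h0 ⟨by linarith [ht.2], by linarith [ht.1]⟩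
  rwa [inner_planeWave_left, neg_neg] at h1

/-- The exponential series approximates `e^{i t z}` uniformly in `t` by polynomials in `z`. -/
lemma isCompactOperator_samplingOp_planeWave {k₀ : ℝ} (hk : 0 < k₀) (a b : ℝ) :
    IsCompactOperator (samplingOp (planeWave k₀) (continuous_planeWave hk) a b) := by
  have hm : ∀ n : ℕ, MemLp (fun t : ℝ => (t * Complex.I) ^ n / (n.factorial : ℂ)) 2
      (bandMeasure k₀) := by
    intro n
    refine MemLp.of_bound (by fun_prop) (k₀ ^ n / n.factorial) ?_
    filter_upwards [ae_bandMeasure_abs_le k₀] with t ht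
    rw [norm_div, norm_pow, norm_mul, Complex.norm_I, mul_one, Complex.norm_real,
      Complex.norm_natCast]
    gcongr
    exact ht
  have hsum : ∀ (z : ℝ) (N : ℕ),
      (∑ n ∈ Finset.range N, ((z : ℂ) ^ n) • (hm n).toLp : Lp ℂ 2 (bandMeasure k₀))
        =ᵐ[bandMeasure k₀]
      fun t => ∑ n ∈ Finset.range N, (t * z * Complex.I) ^ n / (n.factorial : ℂ) := by
    intro z N
    induction N with
    | zero =>
      simp only [Finset.range_zero, Finset.sum_empty]
      exact Lp.coeFn_zero _ _ _
    | succ N ih =>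
      rw [Finset.sum_range_succ]
      filter_upwards [ih, Lp.coeFn_add (∑ n ∈ Finset.range N, ((z : ℂ) ^ n) • (hm n).toLp)
        (((z : ℂ) ^ N) • (hm N).toLp), Lp.coeFn_smul ((z : ℂ) ^ N) ((hm N).toLp),
        (hm N).coeFn_toLp] with t h1 h2 h3 h4
      rw [h2, Pi.add_apply, h1, h3, Pi.smul_apply, h4, Finset.sum_range_succ, smul_eq_mul]
      ring
  set M : ℝ := k₀ * max |a| |b|
  have hM : 0 ≤ M := by positivity
  set c : ℝ := (measureUnivNNReal (bandMeasure k₀) : ℝ) ^ (2 : ℝ≥0∞).toReal⁻¹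
  refine isCompactOperator_samplingOp _ _ a b (fun n => (hm n).toLp)
    (fun N => c * (M ^ N / N.factorial * 2)) ?_ ?_
  · simpa using ((FloorSemiring.tendsto_pow_div_factorial_atTop M).mul_const 2).const_mul c
  · filter_upwards [eventually_ge_atTop ⌈2 * M⌉₊] with N hN z hz
    refine Lp.norm_le_of_ae_bound (by positivity) ?_
    filter_upwards [hsum z N, coeFn_planeWave k₀ z, ae_bandMeasure_abs_le k₀,
      Lp.coeFn_sub (planeWave k₀ z) (∑ n ∈ Finset.range N, ((z : ℂ) ^ n) • (hm n).toLp)]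
      with t h1 h2 h3 h4
    have hx : ‖(t * z * Complex.I : ℂ)‖ ≤ M := by
      rw [norm_mul, norm_mul, Complex.norm_I, mul_one, Complex.norm_real, Complex.norm_real]
      exact mul_le_mul h3 (abs_le_max_abs_abs hz.1 hz.2) (abs_nonneg _) hk.le
    rw [h4, Pi.sub_apply, h1, h2]
    refine (Complex.exp_bound' ?_).trans ?_
    · have h5 : 2 * M ≤ N := (Nat.le_ceil _).trans (by exact_mod_cast hN)
      rw [div_le_iff₀ (by positivity)]
      push_cast
      linarith
    · gcongr

/-! ### Eigensystems of the sinc kernel and Mercer expansion -/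

/-- The adjoint of the sampling operator is injective: `B* f` is the Fourier integral of
`f` restricted to the band, and `f` has bounded support. -/
lemma eq_zero_of_adjoint_samplingOp_eq_zero {k₀ : ℝ} (hk : 0 < k₀) (a b : ℝ)
    {f : Lp ℂ 2 (volume.restrict (Set.Icc a b))}
    (h : (samplingOp (planeWave k₀) (continuous_planeWave hk) a b).adjoint f = 0) : f = 0 := by
  have hf : Integrable f (volume.restrict (Set.Icc a b)) := (Lp.memLp f).integrable (by norm_num)
  have hM : ∀ᵐ z ∂(volume.restrict (Set.Icc a b)), |z| ≤ max |a| |b| := by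
    filter_upwards [self_mem_ae_restrict (measurableSet_Icc (a := a) (b := b))] with z hz
    exact abs_le_max_abs_abs hz.1 hz.2
  set F : ℝ → ℂ := fun t => ∫ z in Set.Icc a b, f z * Complex.exp (t * z * Complex.I) with hFdef
  have hFc : Continuous F := by
    have h1 := (differentiable_integral_mul_cexp hf hM).continuous.comp
      (show Continuous fun t : ℝ => (t : ℂ) * Complex.I by fun_prop)
    convert h1 using 1
    ext t
    simp only [hFdef, Function.comp_apply]
    refine integral_congr_ae (Eventually.of_forall fun z => ?_)
    simp only
    ring_nf
  have hFb : ∀ t, ‖F t‖ ≤ ∫ z in Set.Icc a b, ‖f z‖ := by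
    intro t
    refine (norm_integral_le_integral_norm _).trans (le_of_eq ?_)
    refine integral_congr_ae (Eventually.of_forall fun z => ?_)
    simp only
    rw [norm_mul, ← Complex.ofReal_mul, Complex.norm_exp_ofReal_mul_I, mul_one]
  have hFm : MemLp F 2 (bandMeasure k₀) :=
    MemLp.of_bound hFc.aestronglyMeasurable _ (Eventually.of_forall hFb)
  -- By Fubini, `∫ ‖F‖ ^ 2` is the inner product of `B F` with `f`, that is of `F` with `B* f = 0`.
  have hint : ∫ t, conj (F t) * F t ∂(bandMeasure k₀) = 0 := by
    have h1 : ⟪samplingOp (planeWave k₀) (continuous_planeWave hk) a b hFm.toLp, f⟫ = 0 := by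
      rw [← ContinuousLinearMap.adjoint_inner_right, h, inner_zero_right]
    rw [L2.inner_def] at h1
    rw [← h1]
    have h2 : ∀ t, conj (F t) * F t
        = ∫ z in Set.Icc a b, conj (F t) * (f z * Complex.exp (t * z * Complex.I)) := fun t => by
      rw [integral_const_mul]
    simp_rw [h2]
    rw [integral_integral_swap]
    · refine integral_congr_ae ?_
      filter_upwards [coeFn_samplingOp (planeWave k₀) (continuous_planeWave hk) a b hFm.toLp]
        with z hz
      rw [hz, RCLike.inner_apply, inner_planeWave_left, ← integral_conj, ← integral_const_mul]
      refine integral_congr_ae ?_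
      filter_upwards [hFm.coeFn_toLp] with t ht
      rw [ht, map_mul, ← Complex.exp_conj]
      simp
      ring_nf
    · have h3 : Integrable (fun p : ℝ × ℝ => conj (F p.1) * f p.2)
          ((bandMeasure k₀).prod (volume.restrict (Set.Icc a b))) :=
        Integrable.mul_prod (f := fun t => conj (F t)) ((LinearIsometryEquiv.integrable_comp_iff
          Complex.conjLIE).2 (hFm.integrable (by norm_num))) hf
      have h4 : Integrable (fun p : ℝ × ℝ => conj (F p.1) * f p.2
          * Complex.exp (p.1 * p.2 * Complex.I))
          ((bandMeasure k₀).prod (volume.restrict (Set.Icc a b))) := by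
        refine h3.mul_bdd (c := 1) (by fun_prop) (Eventually.of_forall fun p => ?_)
        rw [← Complex.ofReal_mul, Complex.norm_exp_ofReal_mul_I]
      refine h4.congr (Eventually.of_forall fun p => ?_)
      simp only [Function.uncurry]
      ring
  have hF0 : F =ᵐ[bandMeasure k₀] 0 := by
    have h1 : ∫ t, ‖F t‖ ^ 2 ∂(bandMeasure k₀) = 0 := by
      have h2 : ∀ t, conj (F t) * F t = ((‖F t‖ ^ 2 : ℝ) : ℂ) := fun t => by
        rw [← Complex.normSq_eq_conj_mul_self, Complex.normSq_eq_norm_sq]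
      simp_rw [h2] at hint
      exact Complex.ofReal_injective (integral_ofReal.symm.trans hint)
    rw [integral_eq_zero_iff_of_nonneg (fun t => by positivity)
      (hFm.integrable_norm_pow two_ne_zero)] at h1
    filter_upwards [h1] with t ht
    simpa using ht
  rw [bandMeasure, Filter.EventuallyEq, Measure.ae_ennreal_smul_measure_iff (by simp [hk])] at hF0
  have h0 := Measure.eqOn_Icc_of_ae_eq volume (by linarith : -k₀ < k₀).ne hF0 hFc.continuousOn
    continuousOn_const
  exact Lp.eq_zero_iff_ae_eq_zero.2 (ae_eq_zero_of_fourier_eq_zero_on_Ioo hf hM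
    (by linarith : -k₀ < k₀) fun t ht => h0 (Set.Ioo_subset_Icc_self ht))

/-- Polynomials embed into `L²([a, b])`. -/
lemma not_finiteDimensional_Lp_Icc {a b : ℝ} (hab : a < b) :
    ¬ FiniteDimensional ℂ (Lp ℂ 2 (volume.restrict (Set.Icc a b))) := by
  intro hfd
  have hm : ∀ p : Polynomial ℂ, MemLp (fun z : ℝ => p.eval (z : ℂ)) 2
      (volume.restrict (Set.Icc a b)) := fun p =>
    Continuous.memLp_restrict_Icc (p.continuous.comp Complex.continuous_ofReal) a b 2
  let Φ : Polynomial ℂ →ₗ[ℂ] Lp ℂ 2 (volume.restrict (Set.Icc a b)) :=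
    { toFun := fun p => (hm p).toLp
      map_add' := fun p q => by
        rw [← MemLp.toLp_add]
        congr 1
        ext z
        simp
      map_smul' := fun c p => by
        rw [RingHom.id_apply, ← MemLp.toLp_const_smul]
        congr 1
        ext z
        simp }
  have hinj : Function.Injective Φ := by
    rw [← LinearMap.ker_eq_bot, LinearMap.ker_eq_bot']
    intro p hp
    have h1 : (fun z : ℝ => p.eval (z : ℂ)) =ᵐ[volume.restrict (Set.Icc a b)] fun _ => 0 :=
      (hm p).coeFn_toLp.symm.trans (Lp.eq_zero_iff_ae_eq_zero.1 hp)
    have h2 := Measure.eqOn_Icc_of_ae_eq volume hab.ne h1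
      (p.continuous.comp Complex.continuous_ofReal).continuousOn continuousOn_const
    refine Polynomial.eq_zero_of_infinite_isRoot p ?_
    refine ((Set.Icc_infinite hab).image Complex.ofReal_injective.injOn).mono ?_
    rintro _ ⟨z, hz, rfl⟩
    exact h2 hz
  exact Polynomial.not_finite (R := ℂ) (Module.Finite.of_injective Φ hinj)

/-- The value of `B B* f` at every point `z`, not only almost everywhere. -/
lemma integral_sincKernel_mul {k₀ : ℝ} (hk : 0 < k₀) {a b : ℝ} {f : ℝ → ℂ}
    (hf : MemLp f 2 (volume.restrict (Set.Icc a b))) (z : ℝ) :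
    ∫ z' in Set.Icc a b, sincKernel k₀ z z' * f z'
      = ⟪planeWave k₀ z, (samplingOp (planeWave k₀) (continuous_planeWave hk) a b).adjoint
          hf.toLp⟫ := by
  rw [inner_adjoint_samplingOp]
  refine integral_congr_ae ?_
  filter_upwards [hf.coeFn_toLp] with z' h
  rw [h, inner_planeWave_planeWave hk]

lemma inner_toLp_toLp {α : Type*} [MeasurableSpace α] {μ : Measure α} {f g : α → ℂ}
    (hf : MemLp f 2 μ) (hg : MemLp g 2 μ) : ⟪hf.toLp, hg.toLp⟫ = ∫ z, g z * conj (f z) ∂μ := by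
  rw [L2.inner_def]
  refine integral_congr_ae ?_
  filter_upwards [hf.coeFn_toLp, hg.coeFn_toLp] with z h1 h2
  rw [h1, h2, RCLike.inner_apply]

/-- The eigenvectors of `B B*` in `L²([a, b])` are replaced by their continuous representatives
`(r n)⁻¹ * ⟪e z, B* (x n)⟫`, for which the eigenvalue equation holds at every point. -/
theorem exists_isEigensystem_sincKernel {k₀ : ℝ} (hk : 0 < k₀) {a b : ℝ} (hab : a < b) :
    ∃ (lam : ℕ → ℝ) (phi : ℕ → ℝ → ℂ), IsEigensystem (sincKernel k₀) (Set.Icc a b) lam phi := by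
  set B := samplingOp (planeWave k₀) (continuous_planeWave hk) a b with hB
  have hBc : IsCompactOperator B := isCompactOperator_samplingOp_planeWave hk a b
  have hTc : IsCompactOperator (B ∘L B.adjoint) := hBc.comp_clm B.adjoint
  obtain ⟨r, x, hanti, hr0, horth, heig, hcomp⟩ := exists_eigenvector_sequence
    (not_finiteDimensional_Lp_Icc hab) hTc (ContinuousLinearMap.isPositive_self_comp_adjoint B)
  have hr : ∀ n, r n ≠ 0 := by
    intro n hn
    have h1 : ⟪(B ∘L B.adjoint) (x n), x n⟫ = 0 := by simp [heig, hn]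
    rw [ContinuousLinearMap.comp_apply, ← ContinuousLinearMap.adjoint_inner_right,
      inner_self_eq_zero] at h1
    have h2 := eq_zero_of_adjoint_samplingOp_eq_zero hk a b h1
    have h3 := horth.1 n
    rw [h2, norm_zero] at h3
    exact zero_ne_one h3
  let phi : ℕ → ℝ → ℂ := fun n z => (r n : ℂ)⁻¹ * ⟪planeWave k₀ z, B.adjoint (x n)⟫
  have hphi : ∀ n, phi n =ᵐ[volume.restrict (Set.Icc a b)] x n := by
    intro n
    have h1 : B (B.adjoint (x n)) = (r n : ℂ) • x n := heig n
    have h2 := coeFn_samplingOp (planeWave k₀) (continuous_planeWave hk) a b (B.adjoint (x n))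
    rw [← hB, h1] at h2
    filter_upwards [h2, Lp.coeFn_smul (r n : ℂ) (x n)] with z h3 h4
    have hrn : (r n : ℂ) ≠ 0 := by exact_mod_cast hr n
    simp only [phi]
    rw [← h3, h4, Pi.smul_apply, smul_eq_mul, inv_mul_cancel_left₀ hrn]
  have hmem : ∀ n, MemLp (phi n) 2 (volume.restrict (Set.Icc a b)) := fun n =>
    (Lp.memLp (x n)).ae_eq (hphi n).symm
  have hto : ∀ n, (hmem n).toLp = x n := fun n =>
    Lp.ext ((hmem n).coeFn_toLp.trans (hphi n))
  refine ⟨r, phi, hanti, hmem, fun n m => ?_, fun n z _ => ?_, fun f hf h => ?_⟩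
  · rw [← inner_toLp_toLp (hmem m) (hmem n), hto, hto, orthonormal_iff_ite.1 horth]
    simp only [eq_comm]
  · rw [integral_sincKernel_mul hk (hmem n), hto]
    have hrn : (r n : ℂ) ≠ 0 := by exact_mod_cast hr n
    simp only [phi]
    rw [mul_inv_cancel_left₀ hrn]
  · have h1 : B (B.adjoint hf.toLp) = 0 := hcomp _ fun n => by
      rw [← hto, inner_toLp_toLp, h n]
    have h2 := coeFn_samplingOp (planeWave k₀) (continuous_planeWave hk) a b (B.adjoint hf.toLp)
    rw [← hB, h1] at h2
    filter_upwards [h2, Lp.coeFn_zero ℂ 2 (volume.restrict (Set.Icc a b))] with z h3 h4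
    rw [integral_sincKernel_mul hk hf, ← hB, ← h3, h4, Pi.zero_apply]

/-- The basis is `w n = (lam n)^(-1/2) B* (phi n)`. Positivity of the eigenvalues comes from
injectivity of `B*`, completeness of the basis from completeness of the eigensystem together with
injectivity of `B` and `B*`. -/
theorem IsEigensystem.exists_hilbertBasis {k₀ : ℝ} (hk : 0 < k₀) {a b : ℝ} (hab : a < b)
    {lam : ℕ → ℝ} {phi : ℕ → ℝ → ℂ}
    (hE : IsEigensystem (sincKernel k₀) (Set.Icc a b) lam phi) :
    (∀ n, 0 < lam n) ∧ ∃ w : HilbertBasis ℕ ℂ (Lp ℂ 2 (bandMeasure k₀)),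
      ∀ n, ∀ z ∈ Set.Icc a b, ⟪planeWave k₀ z, w n⟫ = (Real.sqrt (lam n) : ℝ) * phi n z := by
  set B := samplingOp (planeWave k₀) (continuous_planeWave hk) a b with hB
  set x : ℕ → Lp ℂ 2 (volume.restrict (Set.Icc a b)) := fun n => (hE.memLp n).toLp with hx
  have horth : Orthonormal ℂ x := by
    rw [orthonormal_iff_ite]
    intro n m
    rw [hx, inner_toLp_toLp, hE.orthonormal]
    simp only [eq_comm]
  have hu : ∀ n, ∀ z ∈ Set.Icc a b, ⟪planeWave k₀ z, B.adjoint (x n)⟫ = lam n * phi n z := by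
    intro n z hz
    rw [← hE.eigen n z hz, integral_sincKernel_mul hk (hE.memLp n)]
  have hBB : ∀ n, B (B.adjoint (x n)) = (lam n : ℂ) • x n := by
    intro n
    refine Lp.ext ?_
    filter_upwards [coeFn_samplingOp (planeWave k₀) (continuous_planeWave hk) a b (B.adjoint (x n)),
      Lp.coeFn_smul (lam n : ℂ) (x n), (hE.memLp n).coeFn_toLp,
      self_mem_ae_restrict (measurableSet_Icc (a := a) (b := b))] with z h1 h2 h3 hz
    rw [h1, h2, Pi.smul_apply, h3, hu n z hz, smul_eq_mul]
  have hin : ∀ n m, ⟪B.adjoint (x n), B.adjoint (x m)⟫ = if n = m then (lam n : ℂ) else 0 := by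
    intro n m
    rw [ContinuousLinearMap.adjoint_inner_left, hBB, inner_smul_right, orthonormal_iff_ite.1 horth]
    split_ifs with h <;> simp [h]
  have hpos : ∀ n, 0 < lam n := by
    intro n
    have h1 := hin n n
    rw [if_pos rfl, inner_self_eq_norm_sq_to_K] at h1
    have h2 : ‖B.adjoint (x n)‖ ^ 2 = lam n := Complex.ofReal_injective (by simpa using h1)
    rw [← h2]
    have h3 : B.adjoint (x n) ≠ 0 := fun h => by
      have h4 := eq_zero_of_adjoint_samplingOp_eq_zero hk a b h
      have h5 := horth.1 n
      rw [h4, norm_zero] at h5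
      exact zero_ne_one h5
    positivity
  let w : ℕ → Lp ℂ 2 (bandMeasure k₀) := fun n =>
    ((Real.sqrt (lam n))⁻¹ : ℂ) • B.adjoint (x n)
  have hs : ∀ n, (Real.sqrt (lam n) : ℂ) ≠ 0 := fun n => by
    exact_mod_cast (Real.sqrt_pos.2 (hpos n)).ne'
  have hss : ∀ n, (Real.sqrt (lam n) : ℂ) * Real.sqrt (lam n) = lam n := fun n => by
    rw [← Complex.ofReal_mul, Real.mul_self_sqrt (hpos n).le]
  have hw : Orthonormal ℂ w := by
    rw [orthonormal_iff_ite]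
    intro n m
    simp only [w]
    rw [inner_smul_left, inner_smul_right, hin]
    split_ifs with h
    · subst h
      rw [← hss n, map_inv₀, Complex.conj_ofReal]
      field_simp [hs n]
    · simp
  have hbot : (Submodule.span ℂ (Set.range w))ᗮ = ⊥ := by
    rw [Submodule.eq_bot_iff]
    intro v hv
    have h1 : ∀ n, ⟪x n, B v⟫ = 0 := by
      intro n
      have h2 := hv (w n) (Submodule.subset_span ⟨n, rfl⟩)
      simp only [w] at h2
      rw [inner_smul_left, mul_eq_zero, map_inv₀, Complex.conj_ofReal] at h2
      rw [← ContinuousLinearMap.adjoint_inner_left]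
      exact h2.resolve_left (inv_ne_zero (hs n))
    have hBv : MemLp (B v) 2 (volume.restrict (Set.Icc a b)) := Lp.memLp _
    have hBv' : hBv.toLp = B v := Lp.toLp_coeFn _ _
    have h3 := hE.complete (B v) hBv fun n => by
      rw [← inner_toLp_toLp (hE.memLp n) hBv, hBv']
      exact h1 n
    have h4 : B.adjoint (B v) = 0 := by
      refine eq_zero_of_inner_planeWave_eq_zero hk hab ?_
      filter_upwards [h3] with z hz
      rw [integral_sincKernel_mul hk hBv, hBv'] at hz
      exact hz
    have h5 : B v = 0 := by
      rw [← inner_self_eq_zero (𝕜 := ℂ), ← ContinuousLinearMap.adjoint_inner_left, h4,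
        inner_zero_left]
    refine eq_zero_of_inner_planeWave_eq_zero hk hab ?_
    have h6 := coeFn_samplingOp (planeWave k₀) (continuous_planeWave hk) a b v
    rw [← hB, h5] at h6
    filter_upwards [h6, Lp.coeFn_zero ℂ 2 (volume.restrict (Set.Icc a b))] with z h7 h8
    rw [← h7, h8, Pi.zero_apply]
  refine ⟨hpos, HilbertBasis.mkOfOrthogonalEqBot hw hbot, fun n z hz => ?_⟩
  rw [HilbertBasis.coe_mkOfOrthogonalEqBot]
  simp only [w]
  rw [inner_smul_right, hu n z hz, ← hss n, mul_assoc, inv_mul_cancel_left₀ (hs n)]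

/-- Mercer's formula, as Parseval's identity for two plane waves. -/
theorem IsEigensystem.hasSum_sincKernel {k₀ : ℝ} (hk : 0 < k₀) {a b : ℝ} (hab : a < b)
    {lam : ℕ → ℝ} {phi : ℕ → ℝ → ℂ}
    (hE : IsEigensystem (sincKernel k₀) (Set.Icc a b) lam phi) {z z' : ℝ} (hz : z ∈ Set.Icc a b)
    (hz' : z' ∈ Set.Icc a b) :
    HasSum (fun n => (lam n : ℂ) * phi n z * conj (phi n z')) (sincKernel k₀ z z') := by
  obtain ⟨hpos, w, hw⟩ := hE.exists_hilbertBasis hk hab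
  rw [← inner_planeWave_planeWave hk]
  have h : (fun n => (lam n : ℂ) * phi n z * conj (phi n z'))
      = fun n => ⟪planeWave k₀ z, w n⟫ * ⟪w n, planeWave k₀ z'⟫ := by
    ext n
    rw [hw n z hz, ← inner_conj_symm, hw n z' hz', map_mul, Complex.conj_ofReal,
      show ((lam n : ℝ) : ℂ) = (Real.sqrt (lam n) : ℂ) * Real.sqrt (lam n) by
        rw [← Complex.ofReal_mul, Real.mul_self_sqrt (hpos n).le]]
    ring
  rw [h]
  exact w.hasSum_inner_mul_inner (planeWave k₀ z) (planeWave k₀ z')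

/-- The sinc kernel is real, so complex conjugation preserves its eigensystems. -/
lemma IsEigensystem.conj {k₀ : ℝ} {S : Set ℝ} {lam : ℕ → ℝ} {phi : ℕ → ℝ → ℂ}
    (hE : IsEigensystem (sincKernel k₀) S lam phi) :
    IsEigensystem (sincKernel k₀) S lam (fun n z => conj (phi n z)) where
  antitone := hE.antitone
  memLp n := (hE.memLp n).star
  orthonormal n m := by
    simpa [mul_comm, eq_comm] using hE.orthonormal m n
  eigen n z hz := by
    have := congrArg conj (hE.eigen n z hz)
    rw [← integral_conj] at this
    simpa [sincKernel] using this
  complete f hf h := by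
    have h1 := hE.complete (fun z => conj (f z)) hf.star fun n => by
      have := congrArg conj (h n)
      rw [← integral_conj] at this
      simpa using this
    filter_upwards [h1] with z hz
    have := congrArg conj hz
    rw [← integral_conj] at this
    simpa [sincKernel] using this

/-! ### The squared modulus of a complex Gaussian -/

lemma charFun_expMeasure_one (t : ℝ) : charFun (expMeasure 1) t = (1 - t * Complex.I)⁻¹ := by
  have hexp : expMeasure 1 = volume.withDensity (exponentialPDF 1) := rfl
  rw [charFun_apply_real, hexp, integral_withDensity_eq_integral_toReal_smul (f := exponentialPDF 1)
    (measurable_exponentialPDFReal 1).ennreal_ofReal (by simp [exponentialPDF])]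
  have h1 : (fun x : ℝ => (exponentialPDF 1 x).toReal • Complex.exp (t * x * Complex.I))
      = Set.indicator (Set.Ici 0) (fun x : ℝ => Complex.exp ((t * Complex.I - 1) * x)) := by
    ext x
    by_cases hx : 0 ≤ x
    · rw [Set.indicator_of_mem (by exact hx), exponentialPDF_of_nonneg hx,
        ENNReal.toReal_ofReal (by positivity), Complex.real_smul, one_mul, one_mul,
        Complex.ofReal_exp, ← Complex.exp_add]
      congr 1
      push_cast
      ring
    · rw [Set.indicator_of_notMem (by simpa using hx), exponentialPDF_of_neg (by linarith)]
      simp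
  rw [h1, integral_indicator measurableSet_Ici, integral_Ici_eq_integral_Ioi,
    integral_exp_mul_complex_Ioi (by simp)]
  simp only [Complex.ofReal_zero, mul_zero, Complex.exp_zero]
  rw [← neg_sub (t * Complex.I : ℂ) 1, inv_neg, neg_div, one_div]

/-- The square is the characteristic function of the sum of the squares of two independent
`N(0, 1/2)` variables. -/
lemma sq_integral_gaussianReal_cexp_sq (t : ℝ) :
    (∫ x, Complex.exp (t * (x ^ 2 : ℝ) * Complex.I) ∂(gaussianReal 0 (1 / 2))) ^ 2
      = (1 - t * Complex.I)⁻¹ := by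
  rw [integral_gaussianReal_eq_integral_smul (by norm_num)]
  have h1 : ∀ x : ℝ, gaussianPDFReal 0 (1 / 2) x • Complex.exp (t * (x ^ 2 : ℝ) * Complex.I)
      = (((Real.sqrt Real.pi)⁻¹ : ℝ) : ℂ) * Complex.exp (-(1 - t * Complex.I) * x ^ 2) := by
    intro x
    rw [gaussianPDFReal, Complex.real_smul]
    push_cast
    rw [mul_assoc, ← Complex.exp_add]
    congr 1
    · simp only [one_div]
      rw [show (2 : ℝ) * Real.pi * 2⁻¹ = Real.pi by ring]
    · congr 1
      ring
  simp_rw [h1]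
  rw [integral_const_mul, integral_gaussian_complex (by simp), mul_pow, ← Complex.cpow_nat_mul,
    ← Complex.ofReal_pow, inv_pow, Real.sq_sqrt Real.pi_pos.le]
  have hpi : (Real.pi : ℂ) ≠ 0 := by exact_mod_cast Real.pi_ne_zero
  norm_num
  field_simp

/-- The squared modulus of a standard complex Gaussian is standard exponential: both have
characteristic function `1 / (1 - i t)`. -/
lemma map_norm_sq_stdComplexGaussian :
    stdComplexGaussian.map (fun z : ℂ => ‖z‖ ^ 2) = expMeasure 1 := by
  have := isProbabilityMeasure_expMeasure one_pos
  rw [stdComplexGaussian, Measure.map_map (by fun_prop) (by fun_prop)]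
  have : IsProbabilityMeasure (((gaussianReal 0 (1 / 2)).prod (gaussianReal 0 (1 / 2))).map
      ((fun z : ℂ => ‖z‖ ^ 2) ∘ Complex.measurableEquivRealProd.symm)) :=
    Measure.isProbabilityMeasure_map
      (by exact (Measurable.comp (by fun_prop) (by fun_prop)).aemeasurable)
  refine Measure.ext_of_charFun (funext fun t => ?_)
  rw [charFun_expMeasure_one, charFun_apply_real, integral_map
    (by exact (Measurable.comp (by fun_prop) (by fun_prop)).aemeasurable) (by fun_prop),
    ← sq_integral_gaussianReal_cexp_sq, sq, ← integral_prod_mul]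
  refine integral_congr_ae (Eventually.of_forall fun x => ?_)
  simp only [Function.comp_apply, ← Complex.exp_add, ← Complex.normSq_eq_norm_sq,
    Complex.measurableEquivRealProd_symm_apply, Complex.normSq_mk]
  congr 1
  push_cast
  ring

lemma hasLaw_norm_sq_expMeasure {Ω : Type*} [MeasurableSpace Ω] {P : Measure Ω} {X : Ω → ℂ}
    (hX : HasLaw X stdComplexGaussian P) : HasLaw (fun ω => ‖X ω‖ ^ 2) (expMeasure 1) P where
  aemeasurable := hX.aemeasurable.norm.pow_const 2
  map_eq := by
    rw [← map_norm_sq_stdComplexGaussian, ← hX.map_eq,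
      AEMeasurable.map_map_of_aemeasurable (by fun_prop) hX.aemeasurable]
    rfl

/-! ### The channel kernel and its projection to the band -/

/-- The arcsine integral `∫ dx / √(r² - x²) = π`, whose value does not depend on `r`. -/
lemma lintegral_inv_sqrt_sq_sub_sq {r : ℝ} (hr : 0 < r) :
    ∫⁻ x in Set.Icc (-r) r, ENNReal.ofReal (Real.sqrt (r ^ 2 - x ^ 2))⁻¹
      = ENNReal.ofReal Real.pi := by
  have hle : -r ≤ r := by linarith
  have hcont : ContinuousOn (fun x => Real.arcsin (x / r)) (Set.Icc (-r) r) := by fun_prop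
  have hderiv : ∀ x ∈ Set.Ioo (-r) r,
      HasDerivAt (fun x => Real.arcsin (x / r)) (Real.sqrt (r ^ 2 - x ^ 2))⁻¹ x := by
    intro x hx
    have h1 : x / r ≠ -1 := by
      rw [Ne, div_eq_iff hr.ne']
      linarith [hx.1]
    have h2 : x / r ≠ 1 := by
      rw [Ne, div_eq_iff hr.ne']
      linarith [hx.2]
    have h3 := (Real.hasDerivAt_arcsin h1 h2).comp x ((hasDerivAt_id x).div_const r)
    have h4 : 1 - (x / r) ^ 2 = (r ^ 2 - x ^ 2) / r ^ 2 := by field_simp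
    refine h3.congr_deriv ?_
    rw [h4, Real.sqrt_div' _ (by positivity), Real.sqrt_sq hr.le]
    field_simp
  have hint := intervalIntegral.integrableOn_deriv_of_nonneg hcont hderiv
    (fun x _ => by positivity)
  have hval := intervalIntegral.integral_eq_sub_of_hasDerivAt_of_le hle hcont hderiv
    ((intervalIntegrable_iff_integrableOn_Ioc_of_le hle).2 hint)
  rw [intervalIntegral.integral_of_le hle] at hval
  rw [setLIntegral_congr Ioc_ae_eq_Icc.symm, ← ofReal_integral_eq_lintegral_ofReal hint
    (Eventually.of_forall fun x => by positivity), hval, div_self hr.ne', neg_div, div_self hr.ne',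
    Real.arcsin_one, Real.arcsin_neg_one]
  congr 1
  ring

lemma measurableSet_waveDisc (k₀ : ℝ) : MeasurableSet (waveDisc k₀) :=
  measurableSet_le (by fun_prop) (by fun_prop)

@[fun_prop]
lemma measurable_gammaY (k₀ : ℝ) : Measurable (gammaY k₀) := by
  unfold gammaY
  fun_prop

/-- On the horizontal section of the disc at height `y` the weight `1 / γ` has an arcsine profile,
so its integral is the same for all `|y| < k₀`. -/
lemma lintegral_indicator_waveDisc_section {k₀ : ℝ} (hk : 0 < k₀) {y : ℝ} (hy : |y| ≠ k₀) :
    ∫⁻ x, (waveDisc k₀).indicator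
        (fun q => ENNReal.ofReal ((2 * Real.pi * k₀)⁻¹ * (gammaY k₀ q)⁻¹)) (x, y)
      = (Set.Icc (-k₀) k₀).indicator (fun _ => ENNReal.ofReal (2 * k₀)⁻¹) y := by
  by_cases hyk : |y| ≤ k₀
  · have hlt : |y| < k₀ := lt_of_le_of_ne hyk hy
    have hpos : 0 < k₀ ^ 2 - y ^ 2 := by
      have := sq_lt_sq' (by linarith [abs_nonneg y]) hlt
      rw [sq_abs] at this
      linarith
    set r := Real.sqrt (k₀ ^ 2 - y ^ 2)
    have hr : 0 < r := Real.sqrt_pos.2 hpos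
    have hr2 : r ^ 2 = k₀ ^ 2 - y ^ 2 := Real.sq_sqrt hpos.le
    have h1 : ∀ x, (waveDisc k₀).indicator
        (fun q => ENNReal.ofReal ((2 * Real.pi * k₀)⁻¹ * (gammaY k₀ q)⁻¹)) (x, y)
        = ENNReal.ofReal (2 * Real.pi * k₀)⁻¹ * (Set.Icc (-r) r).indicator
          (fun x => ENNReal.ofReal (Real.sqrt (r ^ 2 - x ^ 2))⁻¹) x := by
      intro x
      have hmem : (x, y) ∈ waveDisc k₀ ↔ x ∈ Set.Icc (-r) r := by
        rw [Set.mem_Icc, ← abs_le, ← sq_le_sq₀ (abs_nonneg x) hr.le, sq_abs, hr2]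
        simp only [waveDisc, Set.mem_ofPred_eq]
        constructor <;> intro h <;> linarith
      by_cases hx : (x, y) ∈ waveDisc k₀
      · rw [Set.indicator_of_mem hx, Set.indicator_of_mem (hmem.1 hx),
          ENNReal.ofReal_mul (by positivity), gammaY, hr2]
        congr 4
        ring
      · rw [Set.indicator_of_notMem hx, Set.indicator_of_notMem (fun h => hx (hmem.2 h)), mul_zero]
    simp_rw [h1]
    rw [lintegral_const_mul _ (Measurable.indicator (by fun_prop) measurableSet_Icc),
      lintegral_indicator measurableSet_Icc, lintegral_inv_sqrt_sq_sub_sq hr,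
      Set.indicator_of_mem (show y ∈ Set.Icc (-k₀) k₀ from abs_le.1 hyk),
      ← ENNReal.ofReal_mul (by positivity)]
    congr 1
    field_simp [Real.pi_ne_zero]
  · rw [Set.indicator_of_notMem (show y ∉ Set.Icc (-k₀) k₀ from fun h => hyk (abs_le.2 h))]
    have h1 : ∀ x, (x, y) ∉ waveDisc k₀ := by
      intro x hx
      simp only [waveDisc, Set.mem_ofPred_eq] at hx
      exact hyk (abs_le_of_sq_le_sq (by nlinarith [sq_nonneg x]) hk.le)
    simp [Set.indicator_of_notMem (h1 _)]

/-- Under the weight `1 / (2 π k₀ γ)` on the disc, the second coordinate is uniformly distributed on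
the band. -/
lemma lintegral_waveDisc {k₀ : ℝ} (hk : 0 < k₀) {g : ℝ → ℝ≥0∞} (hg : Measurable g) :
    ∫⁻ q in waveDisc k₀, ENNReal.ofReal ((2 * Real.pi * k₀)⁻¹ * (gammaY k₀ q)⁻¹) * g q.2
      = ∫⁻ t, g t ∂(bandMeasure k₀) := by
  have hm : Measurable ((waveDisc k₀).indicator
      (fun q => ENNReal.ofReal ((2 * Real.pi * k₀)⁻¹ * (gammaY k₀ q)⁻¹))) :=
    Measurable.indicator (by fun_prop) (measurableSet_waveDisc k₀)
  rw [← lintegral_indicator (measurableSet_waveDisc k₀)]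
  have h1 : ∀ q : ℝ × ℝ, (waveDisc k₀).indicator
      (fun q => ENNReal.ofReal ((2 * Real.pi * k₀)⁻¹ * (gammaY k₀ q)⁻¹) * g q.2) q
      = (waveDisc k₀).indicator
        (fun q => ENNReal.ofReal ((2 * Real.pi * k₀)⁻¹ * (gammaY k₀ q)⁻¹)) q * g q.2 := by
    intro q
    by_cases hq : q ∈ waveDisc k₀ <;> simp [hq]
  simp_rw [h1]
  rw [Measure.volume_eq_prod, lintegral_prod_symm _ (by fun_prop)]
  have hae : ∀ᵐ y : ℝ, |y| ≠ k₀ := by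
    have : ∀ᵐ y : ℝ, y ∉ ({k₀, -k₀} : Set ℝ) :=
      measure_eq_zero_iff_ae_notMem.1 (Set.Finite.measure_zero (by simp) _)
    filter_upwards [this] with y hy h
    exact hy (by simpa using eq_or_eq_neg_of_abs_eq h)
  rw [bandMeasure, lintegral_smul_measure, smul_eq_mul, ← lintegral_const_mul _ hg,
    ← lintegral_indicator measurableSet_Icc]
  refine lintegral_congr_ae ?_
  filter_upwards [hae] with y hy
  rw [lintegral_mul_const _ (by fun_prop), lintegral_indicator_waveDisc_section hk hy]
  by_cases h : y ∈ Set.Icc (-k₀) k₀ <;> simp [h]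

lemma channelKernel_eq_mul_cexp (k₀ : ℝ) (p : Fin 3 → ℝ) (z : ℝ) (q : (ℝ × ℝ) × (ℝ × ℝ)) :
    channelKernel k₀ p ![0, 0, z] q
      = channelKernel k₀ p ![0, 0, 0] q * Complex.exp (q.2.2 * z * Complex.I) := by
  simp only [channelKernel, waveVec, dotProduct, Fin.sum_univ_three, Matrix.cons_val_zero,
    Matrix.cons_val_one, Matrix.cons_val, mul_zero, zero_add, add_zero, Complex.ofReal_zero,
    Complex.exp_zero, mul_one, Complex.ofReal_mul, mul_comm Complex.I,
    zero_mul]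

@[fun_prop]
lemma measurable_channelKernel (k₀ : ℝ) (p t : Fin 3 → ℝ) : Measurable (channelKernel k₀ p t) := by
  unfold channelKernel waveVec
  simp only [dotProduct, Fin.sum_univ_three, Matrix.cons_val_zero, Matrix.cons_val_one,
    Matrix.cons_val]
  fun_prop

/-- The phases drop out, and `(2π)⁻⁴ (2π / k₀)² = (2 π k₀)⁻²` is split evenly between the factors.
On the boundary of the disc, where `γ = 0`, both sides are `0`. -/
lemma enorm_sq_channelKernel {k₀ : ℝ} (hk : 0 < k₀) (p t : Fin 3 → ℝ) (q : (ℝ × ℝ) × (ℝ × ℝ)) :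
    ‖channelKernel k₀ p t q‖ₑ ^ 2
      = ENNReal.ofReal ((2 * Real.pi * k₀)⁻¹ * (gammaY k₀ q.1)⁻¹)
        * ENNReal.ofReal ((2 * Real.pi * k₀)⁻¹ * (gammaY k₀ q.2)⁻¹) := by
  have h0 : ∀ q, 0 ≤ gammaY k₀ q := fun q => Real.sqrt_nonneg _
  rw [← ofReal_norm, ← ENNReal.ofReal_pow (norm_nonneg _),
    ← ENNReal.ofReal_mul (mul_nonneg (by positivity) (inv_nonneg.2 (h0 _)))]
  congr 1
  have h1 : ∀ x : ℝ, ‖Complex.exp (-Complex.I * (x : ℂ))‖ = 1 := fun x => by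
    have := Complex.norm_exp_ofReal_mul_I (-x)
    rwa [show ((-x : ℝ) : ℂ) * Complex.I = -Complex.I * x by push_cast; ring] at this
  have h2 : ∀ x : ℝ, ‖Complex.exp (Complex.I * (x : ℂ))‖ = 1 := fun x => by
    rw [mul_comm, Complex.norm_exp_ofReal_mul_I]
  rw [channelKernel, norm_mul, norm_mul, norm_mul, h1, h2, Complex.norm_real, Complex.norm_real,
    Real.norm_of_nonneg (by positivity), Real.norm_of_nonneg (by positivity), mul_one, mul_one,
    mul_pow, div_pow _ (Real.sqrt _), Real.sq_sqrt (mul_nonneg (h0 _) (h0 _))]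
  field_simp

/-- The push-forward to the band of the wavenumber measure weighted by the squared channel
kernel. -/
theorem map_withDensity_channelKernel {k₀ : ℝ} (hk : 0 < k₀) (p : Fin 3 → ℝ) :
    ((waveMeasure k₀).withDensity (fun q => ‖channelKernel k₀ p ![0, 0, 0] q‖ₑ ^ 2)).map
      (fun q : (ℝ × ℝ) × (ℝ × ℝ) => q.2.2) = bandMeasure k₀ := by
  refine Measure.ext_of_lintegral _ fun g hg => ?_
  rw [lintegral_map hg (by fun_prop), lintegral_withDensity_eq_lintegral_mul _ (by fun_prop)
    (by fun_prop)]
  have h1 : ∀ q : (ℝ × ℝ) × (ℝ × ℝ),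
      ((fun q => ‖channelKernel k₀ p ![0, 0, 0] q‖ₑ ^ 2) * fun q : (ℝ × ℝ) × (ℝ × ℝ) => g q.2.2) q
      = ENNReal.ofReal ((2 * Real.pi * k₀)⁻¹ * (gammaY k₀ q.1)⁻¹)
        * (ENNReal.ofReal ((2 * Real.pi * k₀)⁻¹ * (gammaY k₀ q.2)⁻¹) * g q.2.2) := fun q => by
    rw [Pi.mul_apply, enorm_sq_channelKernel hk, mul_assoc]
  simp_rw [h1]
  rw [waveMeasure, lintegral_prod_mul
    (f := fun q : ℝ × ℝ => ENNReal.ofReal ((2 * Real.pi * k₀)⁻¹ * (gammaY k₀ q)⁻¹))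
    (g := fun q : ℝ × ℝ => ENNReal.ofReal ((2 * Real.pi * k₀)⁻¹ * (gammaY k₀ q)⁻¹) * g q.2)
    (by fun_prop) (by fun_prop), lintegral_waveDisc hk hg]
  have h2 := lintegral_waveDisc hk (g := fun _ => 1) measurable_const
  simp only [mul_one] at h2
  rw [h2, lintegral_one]
  have h3 : bandMeasure k₀ Set.univ = 1 := by
    rw [bandMeasure, Measure.smul_apply, Measure.restrict_apply_univ, Real.volume_Icc, smul_eq_mul,
      ← ENNReal.ofReal_mul (by positivity), sub_neg_eq_add, ← two_mul,
      inv_mul_cancel₀ (by positivity), ENNReal.ofReal_one]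
  rw [h3, one_mul]

lemma memLp_channelKernel_mul {k₀ : ℝ} (hk : 0 < k₀) (p : Fin 3 → ℝ) {F : ℝ → ℂ}
    (hF : Measurable F) (hF2 : MemLp F 2 (bandMeasure k₀)) :
    MemLp (fun q : (ℝ × ℝ) × (ℝ × ℝ) => channelKernel k₀ p ![0, 0, 0] q * F q.2.2) 2
      (waveMeasure k₀) := by
  refine ⟨(by fun_prop : Measurable _).aestronglyMeasurable, ?_⟩
  rw [eLpNorm_lt_top_iff_lintegral_rpow_enorm_lt_top two_ne_zero ENNReal.ofNat_ne_top]
  have h1 := (eLpNorm_lt_top_iff_lintegral_rpow_enorm_lt_top two_ne_zero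
    ENNReal.ofNat_ne_top).1 hF2.2
  rw [← map_withDensity_channelKernel hk p, lintegral_map (by fun_prop) (by fun_prop),
    lintegral_withDensity_eq_lintegral_mul _ (by fun_prop) (by fun_prop)] at h1
  convert h1 using 2
  ext q
  simp [mul_pow]

lemma integral_channelKernel_mul_conj {k₀ : ℝ} (hk : 0 < k₀) (p : Fin 3 → ℝ) {F G : ℝ → ℂ}
    (hF : Measurable F) (hG : Measurable G) :
    ∫ q, channelKernel k₀ p ![0, 0, 0] q * F q.2.2
        * conj (channelKernel k₀ p ![0, 0, 0] q * G q.2.2) ∂(waveMeasure k₀)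
      = ∫ t, F t * conj (G t) ∂(bandMeasure k₀) := by
  rw [← map_withDensity_channelKernel hk p, integral_map (by fun_prop)
    (by exact (hF.mul (Complex.continuous_conj.measurable.comp hG)).aestronglyMeasurable),
    integral_withDensity_eq_integral_toReal_smul (by fun_prop) (Eventually.of_forall fun q => by
      simp)]
  refine integral_congr_ae (Eventually.of_forall fun q => ?_)
  simp only [ENNReal.toReal_pow, toReal_enorm, Complex.real_smul, map_mul]
  rw [← Complex.normSq_eq_norm_sq, ← Complex.mul_conj]
  ring

/-! ### Circular Gaussian fields -/

/-- A map which preserves inner products, though not assumed linear, preserves distances to linear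
combinations. -/
lemma norm_sub_sum_of_inner_eq {H K ι : Type*} [NormedAddCommGroup H] [InnerProductSpace ℂ H]
    [NormedAddCommGroup K] [InnerProductSpace ℂ K] {V : H → K}
    (hV : ∀ f g, ⟪V f, V g⟫ = ⟪f, g⟫) (f : H) (s : Finset ι) (c : ι → ℂ) (g : ι → H) :
    ‖V f - ∑ i ∈ s, c i • V (g i)‖ = ‖f - ∑ i ∈ s, c i • g i‖ := by
  rw [← sq_eq_sq₀ (norm_nonneg _) (norm_nonneg _), @norm_sq_eq_re_inner ℂ, @norm_sq_eq_re_inner ℂ]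
  simp only [inner_sub_left, inner_sub_right, inner_sum, sum_inner, inner_smul_left,
    inner_smul_right, hV]

lemma HilbertBasis.norm_sub_sum_le {H ι : Type*} [NormedAddCommGroup H] [InnerProductSpace ℂ H]
    (w : HilbertBasis ι ℂ H) (f : H) (s : Finset ι) :
    ‖f - ∑ i ∈ s, ⟪w i, f⟫ • w i‖ ≤ ‖f‖ := by
  have h0 : ⟪f - ∑ i ∈ s, ⟪w i, f⟫ • w i, ∑ i ∈ s, ⟪w i, f⟫ • w i⟫ = 0 := by
    rw [inner_sum]
    refine Finset.sum_eq_zero fun i hi => ?_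
    rw [inner_smul_right, inner_sub_left, w.orthonormal.inner_left_sum _ hi, inner_conj_symm,
      sub_self, mul_zero]
  have h1 := norm_add_sq_eq_norm_sq_add_norm_sq_of_inner_eq_zero _ _ h0
  rw [sub_add_cancel] at h1
  nlinarith [norm_nonneg f, norm_nonneg (f - ∑ i ∈ s, ⟪w i, f⟫ • w i),
    mul_self_nonneg ‖∑ i ∈ s, ⟪w i, f⟫ • w i‖]

section Field

variable {Ω T : Type*} [MeasurableSpace Ω] {P : Measure Ω} {X : T → Ω → ℂ} {C : T → T → ℂ}

lemma IsCircularGaussianField.memLp_two (hX : IsCircularGaussianField P X C) (t : T) :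
    MemLp (X t) 2 P :=
  (hX.gaussian.hasGaussianLaw_eval t).memLp_two

lemma IsCircularGaussianField.inner_toLp (hX : IsCircularGaussianField P X C) (s t : T) :
    ⟪(hX.memLp_two s).toLp, (hX.memLp_two t).toLp⟫ = C t s := by
  rw [inner_toLp_toLp, hX.autocorr]

/-- Two variables of the field whose difference has variance `0` agree almost surely. -/
lemma IsCircularGaussianField.ae_eq (hX : IsCircularGaussianField P X C) {s t : T}
    (h1 : C s t = C s s) (h2 : C t s = C s s) (h3 : C t t = C s s) : X s =ᵐ[P] X t := by
  have h : (hX.memLp_two s).toLp = (hX.memLp_two t).toLp := by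
    rw [← sub_eq_zero, ← inner_self_eq_zero (𝕜 := ℂ), inner_sub_left, inner_sub_right,
      inner_sub_right, hX.inner_toLp, hX.inner_toLp, hX.inner_toLp, hX.inner_toLp, h1, h2, h3]
    ring
  exact (MemLp.toLp_eq_toLp_iff _ _).1 h

lemma IsCircularGaussianField.comp {S : Type*} (hX : IsCircularGaussianField P X C) (f : S → T) :
    IsCircularGaussianField P (fun s => X (f s)) (fun s t => C (f s) (f t)) where
  gaussian := hX.gaussian.comp_right f
  mean_zero _ := hX.mean_zero _
  autocorr _ _ := hX.autocorr _ _
  pseudo_zero _ _ := hX.pseudo_zero _ _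

lemma IsCircularGaussianField.congr {Y : T → Ω → ℂ} (hX : IsCircularGaussianField P X C)
    (h : ∀ t, X t =ᵐ[P] Y t) : IsCircularGaussianField P Y C where
  gaussian := hX.gaussian.congr h
  mean_zero t := (integral_congr_ae (h t)).symm.trans (hX.mean_zero t)
  autocorr s t := by
    rw [← hX.autocorr s t]
    refine integral_congr_ae ?_
    filter_upwards [h s, h t] with ω h1 h2
    rw [h1, h2]
  pseudo_zero s t := by
    rw [← hX.pseudo_zero s t]
    refine integral_congr_ae ?_
    filter_upwards [h s, h t] with ω h1 h2
    rw [h1, h2]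

/-- The autocorrelation and the vanishing pseudo-autocorrelation together determine all covariances
of real and imaginary parts. -/
lemma IsCircularGaussianField.integral_re_im (hX : IsCircularGaussianField P X C) (s t : T) :
    ∫ ω, (X s ω).re * (X t ω).re ∂P = (C s t).re / 2 ∧
    ∫ ω, (X s ω).im * (X t ω).im ∂P = (C s t).re / 2 ∧
    ∫ ω, (X s ω).im * (X t ω).re ∂P = (C s t).im / 2 ∧
    ∫ ω, (X s ω).re * (X t ω).im ∂P = - (C s t).im / 2 := by
  have hi1 : Integrable (fun ω => X s ω * conj (X t ω)) P :=
    (hX.memLp_two s).integrable_mul (hX.memLp_two t).star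
  have hi2 : Integrable (fun ω => X s ω * X t ω) P :=
    (hX.memLp_two s).integrable_mul (hX.memLp_two t)
  have ha := hX.autocorr s t
  have hb := hX.pseudo_zero s t
  have har : ∫ ω, (X s ω * conj (X t ω)).re ∂P = (C s t).re := by
    rw [← ha]; exact integral_re hi1
  have hai : ∫ ω, (X s ω * conj (X t ω)).im ∂P = (C s t).im := by
    rw [← ha]; exact integral_im hi1
  have hbr : ∫ ω, (X s ω * X t ω).re ∂P = 0 := by
    have := integral_re hi2
    rw [hb] at this
    exact this
  have hbi : ∫ ω, (X s ω * X t ω).im ∂P = 0 := by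
    have := integral_im hi2
    rw [hb] at this
    exact this
  refine ⟨?_, ?_, ?_, ?_⟩
  · rw [← har, ← add_zero (∫ ω, (X s ω * conj (X t ω)).re ∂P), ← hbr,
      ← integral_add (by exact hi1.re) (by exact hi2.re), ← integral_div]
    refine integral_congr_ae (Eventually.of_forall fun ω => ?_)
    simp
  · rw [← har, ← sub_zero (∫ ω, (X s ω * conj (X t ω)).re ∂P), ← hbr,
      ← integral_sub (by exact hi1.re) (by exact hi2.re), ← integral_div]
    refine integral_congr_ae (Eventually.of_forall fun ω => ?_)
    simp
  · rw [← hai, ← add_zero (∫ ω, (X s ω * conj (X t ω)).im ∂P), ← hbi,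
      ← integral_add (by exact hi1.im) (by exact hi2.im), ← integral_div]
    refine integral_congr_ae (Eventually.of_forall fun ω => ?_)
    simp
    ring
  · rw [← hai, ← zero_sub, ← hbi,
      ← integral_sub (by exact hi2.im) (by exact hi1.im), ← integral_div]
    refine integral_congr_ae (Eventually.of_forall fun ω => ?_)
    simp

lemma strongDual_complex_apply (L : StrongDual ℝ ℂ) (z : ℂ) :
    L z = z.re * L 1 + z.im * L Complex.I := by
  have : z = z.re • (1 : ℂ) + z.im • Complex.I := by
    simp
  conv_lhs => rw [this, map_add, map_smul, map_smul]
  simp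

/-- For jointly Gaussian variables, vanishing covariances give independence, both between different
indices and between real and imaginary part. -/
lemma IsCircularGaussianField.isIIDComplexGaussian {X : ℕ → Ω → ℂ}
    (hX : IsCircularGaussianField P X (fun n m => if n = m then 1 else 0)) :
    IsIIDComplexGaussian P X := by
  have := hX.gaussian.isProbabilityMeasure
  have hint : ∀ n, Integrable (X n) P := fun n => (hX.memLp_two n).integrable (by norm_num)
  have hre : ∀ n, MemLp (fun ω => (X n ω).re) 2 P := fun n => (hX.memLp_two n).re
  have him : ∀ n, MemLp (fun ω => (X n ω).im) 2 P := fun n => (hX.memLp_two n).im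
  have hre0 : ∀ n, ∫ ω, (X n ω).re ∂P = 0 := fun n => by
    have h := integral_re (hint n)
    rw [hX.mean_zero n] at h
    exact h
  have him0 : ∀ n, ∫ ω, (X n ω).im ∂P = 0 := fun n => by
    have h := integral_im (hint n)
    rw [hX.mean_zero n] at h
    exact h
  refine ⟨fun n => ?_, ?_⟩
  · have hg := hX.gaussian.hasGaussianLaw_eval n
    have hpair : HasGaussianLaw (fun ω => ((X n ω).re, (X n ω).im)) P :=
      hg.map_fun (Complex.reCLM.prod Complex.imCLM)
    obtain ⟨h1, h2, -, h4⟩ := hX.integral_re_im n n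
    simp only [if_true] at h1 h2 h4
    have hind : IndepFun (fun ω => (X n ω).re) (fun ω => (X n ω).im) P := by
      refine hpair.indepFun_of_covariance_eq_zero ?_
      rw [covariance_eq_sub (hre n) (him n), hre0, zero_mul, sub_zero]
      simpa using h4
    have hlre : P.map (fun ω => (X n ω).re) = gaussianReal 0 (1 / 2) := by
      rw [hpair.fst.map_eq_gaussianReal, hre0, variance_of_integral_eq_zero
        (hre n).aestronglyMeasurable.aemeasurable (hre0 n)]
      congr 1
      simp only [sq] at h1 ⊢
      simp only [h1]
      ext; simp
    have hlim : P.map (fun ω => (X n ω).im) = gaussianReal 0 (1 / 2) := by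
      rw [hpair.snd.map_eq_gaussianReal, him0, variance_of_integral_eq_zero
        (him n).aestronglyMeasurable.aemeasurable (him0 n)]
      congr 1
      simp only [sq] at h2 ⊢
      simp only [h2]
      ext; simp
    refine ⟨hg.aemeasurable, ?_⟩
    -- Only one of the two equal factors of the product measure is to be the law of the real part.
    rw [stdComplexGaussian, ← hlre]
    nth_rw 2 [hlre]
    rw [← hlim, ← (indepFun_iff_map_prod_eq_prod_map_map (by fun_prop) (by fun_prop)).1 hind,
      AEMeasurable.map_map_of_aemeasurable (by fun_prop) (by fun_prop)]
    congr 1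
  -- The independence criterion is about families of processes, so each variable is seen as a
  -- process indexed by `Unit`.
  · have hG : IsGaussianProcess (fun (q : (_ : ℕ) × Unit) ω => X q.1 ω) P :=
      hX.gaussian.comp_right (fun q : (_ : ℕ) × Unit => q.1)
    have h := IsGaussianProcess.iIndepFun_of_covariance_strongDual (S := fun _ : ℕ => Unit)
      (X := fun n _ => X n) hG (fun n _ => (hX.memLp_two n).aestronglyMeasurable.aemeasurable)
      (fun n m hnm _ _ L₁ L₂ => by
        obtain ⟨h1, h2, h3, h4⟩ := hX.integral_re_im n m
        simp only [if_neg hnm, Complex.zero_re, Complex.zero_im, neg_zero, zero_div] at h1 h2 h3 h4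
        have e1 : ∀ (L : StrongDual ℝ ℂ) (k : ℕ), (L ∘ X k)
            = (fun ω => (X k ω).re * L 1) + (fun ω => (X k ω).im * L Complex.I) := by
          intro L k
          ext ω
          exact strongDual_complex_apply L _
        have hc : ∀ (f g : Ω → ℝ), MemLp f 2 P → MemLp g 2 P → ∫ ω, f ω ∂P = 0 →
            ∫ ω, f ω * g ω ∂P = 0 → cov[f, g; P] = 0 := by
          intro f g hf hg h0 h1
          rw [covariance_eq_sub hf hg, h0, zero_mul, sub_zero]
          exact h1
        rw [e1, e1, covariance_add_left ((hre n).mul_const _) ((him n).mul_const _)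
            (((hre m).mul_const _).add ((him m).mul_const _)),
          covariance_add_right ((hre n).mul_const _) ((hre m).mul_const _) ((him m).mul_const _),
          covariance_add_right ((him n).mul_const _) ((hre m).mul_const _) ((him m).mul_const _)]
        simp only [covariance_mul_const_left, covariance_mul_const_right]
        rw [hc _ _ (hre n) (hre m) (hre0 n) h1, hc _ _ (hre n) (him m) (hre0 n) h4,
          hc _ _ (him n) (hre m) (him0 n) h3, hc _ _ (him n) (him m) (him0 n) h2]
        simp)
    exact h.comp (fun _ (x : Unit → ℂ) => x ()) (fun _ => measurable_pi_apply _)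

end Field

section Isonormal

variable {Ω H : Type*} [MeasurableSpace Ω] {P : Measure Ω} [NormedAddCommGroup H]
  [InnerProductSpace ℂ H] {G : H → Ω → ℂ}

/-- A Gaussian field with autocorrelation `⟪g, f⟫` is a linear isometry up to null sets. -/
lemma eLpNorm_sub_sum_isonormal (hG : IsCircularGaussianField P G (fun f g => ⟪g, f⟫)) (f : H)
    (s : Finset ℕ) (c : ℕ → ℂ) (g : ℕ → H) :
    eLpNorm (fun ω => G f ω - ∑ n ∈ s, c n * G (g n) ω) 2 P
      = ENNReal.ofReal ‖f - ∑ n ∈ s, c n • g n‖ := by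
  let V : H → Lp ℂ 2 P := fun f => (hG.memLp_two f).toLp
  have hV : ∀ f, (V f : Ω → ℂ) =ᵐ[P] G f := fun f => (hG.memLp_two f).coeFn_toLp
  rw [← norm_sub_sum_of_inner_eq (V := V) (fun f g => hG.inner_toLp f g), Lp.norm_def,
    ENNReal.ofReal_toReal (Lp.eLpNorm_ne_top _)]
  refine eLpNorm_congr_ae ?_
  have h1 : ∀ᵐ ω ∂P, ∀ n, (V (g n) : Ω → ℂ) ω = G (g n) ω := ae_all_iff.2 fun n => hV (g n)
  have h2 : ∀ᵐ ω ∂P, ∀ n, ((c n • V (g n) : Lp ℂ 2 P) : Ω → ℂ) ω = c n * (V (g n) : Ω → ℂ) ω :=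
    ae_all_iff.2 fun n => Lp.coeFn_smul _ _
  filter_upwards [Lp.coeFn_sub (V f) (∑ n ∈ s, c n • V (g n)), hV f, h1, h2,
    Lp.coeFn_fun_finsetSum s (fun n => c n • V (g n))] with ω h3 h4 h5 h6 h7
  rw [h3, Pi.sub_apply, h4, h7]
  simp only [h6, h5]

end Isonormal

/-! ### The channel field as a field indexed by the band -/

lemma eLpNorm_two_sq {α : Type*} [MeasurableSpace α] {μ : Measure α} (f : α → ℂ) :
    eLpNorm f 2 μ ^ 2 = ∫⁻ x, ‖f x‖ₑ ^ 2 ∂μ := by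
  rw [eLpNorm_eq_lintegral_rpow_enorm_toReal two_ne_zero ENNReal.ofNat_ne_top, ENNReal.toReal_ofNat,
    ← ENNReal.rpow_natCast, ← ENNReal.rpow_mul]
  simp

section Noise

variable {Ω : Type*} [MeasurableSpace Ω] {P : Measure Ω} {k₀ : ℝ}
  {W : (((ℝ × ℝ) × (ℝ × ℝ)) → ℂ) → Ω → ℂ}

/-- The stochastic integral of the product of `F (κ_z)` with the channel kernel of the origin. The values of `F` are those of its chosen representative. -/
noncomputable def bandNoise (k₀ : ℝ) (p : Fin 3 → ℝ) (W : (((ℝ × ℝ) × (ℝ × ℝ)) → ℂ) → Ω → ℂ)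
    (F : Lp ℂ 2 (bandMeasure k₀)) : Ω → ℂ :=
  W (fun q => channelKernel k₀ p ![0, 0, 0] q * F q.2.2)

/-- The stochastic integral is isometric on `L²` of the band. -/
lemma IsComplexWhiteNoise.bandNoise (hk : 0 < k₀) (hW : IsComplexWhiteNoise P (waveMeasure k₀) W)
    (p : Fin 3 → ℝ) : IsCircularGaussianField P (bandNoise k₀ p W) (fun F G => ⟪G, F⟫) := by
  have h := IsCircularGaussianField.comp hW (fun F : Lp ℂ 2 (bandMeasure k₀) =>
    (⟨fun q => channelKernel k₀ p ![0, 0, 0] q * F q.2.2, memLp_channelKernel_mul hk p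
      (Lp.stronglyMeasurable F).measurable (Lp.memLp F)⟩ :
      {f : ((ℝ × ℝ) × (ℝ × ℝ)) → ℂ // MemLp f 2 (waveMeasure k₀)}))
  have hC : ∀ F G : Lp ℂ 2 (bandMeasure k₀), ∫ q, channelKernel k₀ p ![0, 0, 0] q * F q.2.2
      * conj (channelKernel k₀ p ![0, 0, 0] q * G q.2.2) ∂(waveMeasure k₀) = ⟪G, F⟫ := by
    intro F G
    rw [integral_channelKernel_mul_conj hk p (Lp.stronglyMeasurable F).measurable
      (Lp.stronglyMeasurable G).measurable, L2.inner_def]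
    simp only [RCLike.inner_apply]
  simp only [hC] at h
  exact h

/-- The stochastic integral does not depend on the representative of the integrand. -/
lemma IsComplexWhiteNoise.channelKernel_mul_ae_eq (hk : 0 < k₀)
    (hW : IsComplexWhiteNoise P (waveMeasure k₀) W) (p : Fin 3 → ℝ) {F G : ℝ → ℂ}
    (hF : Measurable F) (hF2 : MemLp F 2 (bandMeasure k₀)) (hG : Measurable G)
    (hG2 : MemLp G 2 (bandMeasure k₀)) (hFG : F =ᵐ[bandMeasure k₀] G) :
    W (fun q => channelKernel k₀ p ![0, 0, 0] q * F q.2.2)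
      =ᵐ[P] W (fun q => channelKernel k₀ p ![0, 0, 0] q * G q.2.2) := by
  refine IsCircularGaussianField.ae_eq hW
    (s := ⟨_, memLp_channelKernel_mul hk p hF hF2⟩)
    (t := ⟨_, memLp_channelKernel_mul hk p hG hG2⟩) ?_ ?_ ?_
  · simp only [integral_channelKernel_mul_conj hk p hF hG,
      integral_channelKernel_mul_conj hk p hF hF]
    refine integral_congr_ae ?_
    filter_upwards [hFG] with t ht
    rw [ht]
  · simp only [integral_channelKernel_mul_conj hk p hG hF,
      integral_channelKernel_mul_conj hk p hF hF]
    refine integral_congr_ae ?_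
    filter_upwards [hFG] with t ht
    rw [ht]
  · simp only [integral_channelKernel_mul_conj hk p hG hG,
      integral_channelKernel_mul_conj hk p hF hF]
    refine integral_congr_ae ?_
    filter_upwards [hFG] with t ht
    rw [ht]

lemma IsComplexWhiteNoise.channelKernel_ae_eq (hk : 0 < k₀)
    (hW : IsComplexWhiteNoise P (waveMeasure k₀) W) (p : Fin 3 → ℝ) (z : ℝ) :
    W (channelKernel k₀ p ![0, 0, z]) =ᵐ[P] _root_.bandNoise k₀ p W (planeWave k₀ z) := by
  have h0 : channelKernel k₀ p ![0, 0, z] = fun q => channelKernel k₀ p ![0, 0, 0] q *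
      (fun t : ℝ => Complex.exp (t * z * Complex.I)) q.2.2 :=
    funext fun q => channelKernel_eq_mul_cexp k₀ p z q
  rw [h0]
  exact hW.channelKernel_mul_ae_eq hk p (by fun_prop) (memLp_cexp_bandMeasure k₀ z)
    (Lp.stronglyMeasurable _).measurable (Lp.memLp _) (coeFn_planeWave k₀ z).symm

variable {d L : ℝ} {p : Fin 3 → ℝ} {h : ℝ → Ω → ℂ}

lemma IsChannelField.ae_eq_bandNoise (hk : 0 < k₀) (hW : IsComplexWhiteNoise P (waveMeasure k₀) W)
    (hh : IsChannelField P k₀ d L p W h) {z : ℝ} (hz : z ∈ aperture d L) :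
    h z =ᵐ[P] bandNoise k₀ p W (planeWave k₀ z) :=
  (hh.eq_noise z hz).trans (hW.channelKernel_ae_eq hk p z)

theorem IsChannelField.isCircularGaussianField (hk : 0 < k₀)
    (hW : IsComplexWhiteNoise P (waveMeasure k₀) W) (hh : IsChannelField P k₀ d L p W h) :
    IsCircularGaussianField P (fun z : aperture d L => h z) (fun z z' => sincKernel k₀ z z') := by
  have h1 := ((hW.bandNoise hk p).comp (fun z : aperture d L => planeWave k₀ (z : ℝ))).congr
    (Y := fun z : aperture d L => h z) fun z => (hh.ae_eq_bandNoise hk hW z.2).symm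
  have hC : ∀ z z' : aperture d L, ⟪planeWave k₀ (z' : ℝ), planeWave k₀ (z : ℝ)⟫
      = sincKernel k₀ z z' := fun z z' => by
    rw [inner_planeWave_planeWave hk, sincKernel, sincKernel, ← Real.sinc_neg]
    congr 2
    ring
  simp only [hC] at h1
  exact h1

lemma IsChannelField.lintegral_enorm_sq (hk : 0 < k₀)
    (hW : IsComplexWhiteNoise P (waveMeasure k₀) W) (hh : IsChannelField P k₀ d L p W h) {z : ℝ}
    (hz : z ∈ aperture d L) : ∫⁻ ω, ‖h z ω‖ₑ ^ 2 ∂P = 1 := by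
  have h1 := eLpNorm_sub_sum_isonormal (hW.bandNoise hk p) (planeWave k₀ z) ∅ (fun _ => 0)
    (fun _ => 0)
  simp only [Finset.sum_empty, sub_zero, norm_planeWave hk, ENNReal.ofReal_one] at h1
  rw [← eLpNorm_congr_ae (hh.ae_eq_bandNoise hk hW hz)] at h1
  rw [← eLpNorm_two_sq, h1, one_pow]

/-- The Karhunen–Loève expansion on the original probability space, with coefficients built from the
noise that drives the channel. -/
theorem IsChannelField.exists_isIIDComplexGaussian (hk : 0 < k₀) (hL : 0 < L)
    (hW : IsComplexWhiteNoise P (waveMeasure k₀) W) (hh : IsChannelField P k₀ d L p W h)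
    {lam : ℕ → ℝ} {phi : ℕ → ℝ → ℂ}
    (hE : IsEigensystem (sincKernel k₀) (aperture d L) lam phi) :
    ∃ Psi : ℕ → Ω → ℂ, IsIIDComplexGaussian P Psi ∧ ∀ z ∈ aperture d L,
      Tendsto (fun N => eLpNorm (fun ω => h z ω - klPartialSum lam phi Psi N z ω) 2 P)
        atTop (𝓝 0) ∧
      ∀ N, eLpNorm (fun ω => h z ω - klPartialSum lam phi Psi N z ω) 2 P ≤ 1 := by
  -- The coefficient of `e z` at `w n` is `⟪w n, e z⟫`, the conjugate of `⟪e z, w n⟫`; starting from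
  -- the conjugate eigenfunctions makes it `√(lam n) * phi n z`.
  obtain ⟨-, w, hw⟩ := IsEigensystem.exists_hilbertBasis hk (by linarith) hE.conj
  have hG := hW.bandNoise hk p
  refine ⟨fun n => bandNoise k₀ p W (w n), ?_, fun z hz => ?_⟩
  · refine IsCircularGaussianField.isIIDComplexGaussian ?_
    have h1 := hG.comp w
    have hC : ∀ n m, ⟪w m, w n⟫ = if n = m then (1 : ℂ) else 0 := fun n m => by
      rw [orthonormal_iff_ite.1 w.orthonormal]
      simp only [eq_comm]
    simp only [hC] at h1
    exact h1
  have hc : ∀ n, ⟪w n, planeWave k₀ z⟫ = (Real.sqrt (lam n) : ℝ) * phi n z := fun n => by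
    rw [← inner_conj_symm, hw n z hz]
    simp
  have key : ∀ N, eLpNorm (fun ω => h z ω
      - klPartialSum lam phi (fun n => bandNoise k₀ p W (w n)) N z ω) 2 P
      = ENNReal.ofReal ‖planeWave k₀ z - ∑ n ∈ Finset.range N, ⟪w n, planeWave k₀ z⟫ • w n‖ := by
    intro N
    rw [← eLpNorm_sub_sum_isonormal hG]
    refine eLpNorm_congr_ae ?_
    filter_upwards [hh.ae_eq_bandNoise hk hW hz] with ω hω
    simp only [hω, klPartialSum, hc]
  refine ⟨?_, fun N => ?_⟩
  · simp only [key]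
    rw [← ENNReal.ofReal_zero]
    refine ENNReal.tendsto_ofReal ?_
    have h2 := (w.hasSum_repr (planeWave k₀ z)).tendsto_sum_nat
    simp only [w.repr_apply_apply] at h2
    simpa using ((tendsto_const_nhds (x := planeWave k₀ z)).sub h2).norm
  · rw [key, ← ENNReal.ofReal_one, ← norm_planeWave hk z]
    exact ENNReal.ofReal_le_ofReal (w.norm_sub_sum_le _ _)

end Noise

/-! ### The gain as a random series -/

section Transport

variable {Ω Ω' X : Type*} [MeasurableSpace Ω] [MeasurableSpace Ω'] [MeasurableSpace X]
  {P : Measure Ω} {P' : Measure Ω'}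

/-- A mean-square limit of measurable functions of `T` is itself a measurable function of `T`. -/
lemma exists_measurable_comp_ae_eq {T : Ω → X} (hT : AEMeasurable T P) {S : ℕ → X → ℂ}
    (hS : ∀ N, Measurable (S N)) {g : Ω → ℂ} (hg : AEStronglyMeasurable g P)
    (hlim : Tendsto (fun N => eLpNorm (fun ω => g ω - S N (T ω)) 2 P) atTop (𝓝 0)) :
    ∃ H : X → ℂ, Measurable H ∧ g =ᵐ[P] fun ω => H (T ω) := by
  have h1 : TendstoInMeasure P (fun N ω => S N (T ω)) atTop g := by
    refine tendstoInMeasure_of_tendsto_eLpNorm two_ne_zero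
      (fun N => ((hS N).comp_aemeasurable hT).aestronglyMeasurable) hg ?_
    refine hlim.congr fun N => ?_
    rw [← eLpNorm_neg]
    congr 1
    ext ω
    simp
  obtain ⟨ns, -, hns⟩ := h1.exists_seq_tendsto_ae
  have h2 : ∀ᵐ x ∂(P.map T), ∃ l, Tendsto (fun i => S (ns i) x) atTop (𝓝 l) := by
    rw [ae_map_iff hT (measurableSet_exists_tendsto fun i => hS (ns i))]
    filter_upwards [hns] with ω hω using ⟨_, hω⟩
  obtain ⟨H, hH, hlimH⟩ := measurable_limit_of_tendsto_metrizable_ae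
    (fun i => (hS (ns i)).aemeasurable) h2
  refine ⟨H, hH, ?_⟩
  filter_upwards [hns, ae_of_ae_map hT hlimH] with ω h3 h4
  exact tendsto_nhds_unique h3 h4

end Transport

section Gain

lemma IsEigensystem.lintegral_enorm_sum_sq {R : ℝ → ℝ → ℂ} {S : Set ℝ} {lam : ℕ → ℝ}
    {phi : ℕ → ℝ → ℂ} (hE : IsEigensystem R S lam phi) (c : ℕ → ℂ) (s : Finset ℕ) :
    ∫⁻ z in S, ‖∑ n ∈ s, c n * phi n z‖ₑ ^ 2 = ∑ n ∈ s, ‖c n‖ₑ ^ 2 := by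
  set x : ℕ → Lp ℂ 2 (volume.restrict S) := fun n => (hE.memLp n).toLp with hx
  have hon : Orthonormal ℂ x := orthonormal_iff_ite.2 fun n m => by
    rw [hx, inner_toLp_toLp, hE.orthonormal]
    simp only [eq_comm]
  have hmem : MemLp (fun z => ∑ n ∈ s, c n * phi n z) 2 (volume.restrict S) :=
    memLp_finsetSum s fun n _ => (hE.memLp n).const_mul (c n)
  have h1 : hmem.toLp = ∑ n ∈ s, c n • x n := by
    refine Lp.ext ?_
    have h3 : ∀ᵐ z ∂(volume.restrict S), ∀ n, x n z = phi n z :=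
      ae_all_iff.2 fun n => (hE.memLp n).coeFn_toLp
    have h4 : ∀ᵐ z ∂(volume.restrict S), ∀ n, (c n • x n) z = c n * x n z :=
      ae_all_iff.2 fun n => Lp.coeFn_smul (c n) (x n)
    filter_upwards [hmem.coeFn_toLp, Lp.coeFn_fun_finsetSum s (fun n => c n • x n), h3, h4]
      with z h5 h6 h7 h8
    rw [h5, h6]
    simp only [h7, h8]
  have h2 : ‖∑ n ∈ s, c n • x n‖ ^ 2 = ∑ n ∈ s, ‖c n‖ ^ 2 := by
    have := hon.inner_sum c c s
    rw [inner_self_eq_norm_sq_to_K] at this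
    simp only [Complex.conj_mul'] at this
    apply Complex.ofReal_injective
    push_cast
    exact this
  rw [← eLpNorm_two_sq, ← Lp.enorm_toLp hmem, h1, ← ofReal_norm,
    ← ENNReal.ofReal_pow (norm_nonneg _), h2, ENNReal.ofReal_sum_of_nonneg fun _ _ => by positivity]
  refine Finset.sum_congr rfl fun n _ => ?_
  rw [← ofReal_norm, ENNReal.ofReal_pow (norm_nonneg _)]

lemma IsEigensystem.lintegral_klPartialSum_sq {R : ℝ → ℝ → ℂ} {S : Set ℝ} {lam : ℕ → ℝ}
    {phi : ℕ → ℝ → ℂ} (hE : IsEigensystem R S lam phi) (hlam : ∀ n, 0 ≤ lam n) {Ω : Type*}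
    (Psi : ℕ → Ω → ℂ) (N : ℕ) (ω : Ω) :
    ∫⁻ z in S, ‖klPartialSum lam phi Psi N z ω‖ₑ ^ 2
      = ∑ n ∈ Finset.range N, ENNReal.ofReal (lam n * ‖Psi n ω‖ ^ 2) := by
  have h1 := hE.lintegral_enorm_sum_sq (fun n => ((Real.sqrt (lam n) : ℝ) : ℂ) * Psi n ω)
    (Finset.range N)
  simp only [klPartialSum]
  simp only [mul_right_comm _ (phi _ _) (Psi _ _), h1]
  refine Finset.sum_congr rfl fun n _ => ?_
  rw [← ofReal_norm, ← ENNReal.ofReal_pow (norm_nonneg _), norm_mul, mul_pow, Complex.norm_real,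
    Real.norm_eq_abs, sq_abs, Real.sq_sqrt (hlam n)]

/-- If the `L²` norms of `s N` increase with `N` and the distance of `s N` to `f` comes arbitrarily
close to `0`, then the norms converge to that of `f`. -/
lemma lintegral_enorm_sq_eq_iSup {α : Type*} [MeasurableSpace α] {μ : Measure α} {f : α → ℂ}
    {s : ℕ → α → ℂ} (hf : AEStronglyMeasurable f μ) (hs : ∀ N, AEStronglyMeasurable (s N) μ)
    (hmono : Monotone fun N => ∫⁻ x, ‖s N x‖ₑ ^ 2 ∂μ)
    (hlim : liminf (fun N => ∫⁻ x, ‖f x - s N x‖ₑ ^ 2 ∂μ) atTop = 0) :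
    ∫⁻ x, ‖f x‖ₑ ^ 2 ∂μ = ⨆ N, ∫⁻ x, ‖s N x‖ₑ ^ 2 ∂μ := by
  have hlt : ∀ ε : ℝ≥0, 0 < ε → ∃ᶠ N in atTop, eLpNorm (fun x => f x - s N x) 2 μ < ε := by
    intro ε hε
    have h1 : ∃ᶠ N in atTop, ∫⁻ x, ‖f x - s N x‖ₑ ^ 2 ∂μ < (ε : ℝ≥0∞) ^ 2 := by
      refine frequently_lt_of_liminf_lt (by isBoundedDefault) ?_
      rw [hlim]
      positivity
    refine h1.mono fun N hN => ?_
    rw [← eLpNorm_two_sq] at hN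
    exact (ENNReal.pow_lt_pow_left_iff two_ne_zero).1 hN
  simp only [← eLpNorm_two_sq] at hmono ⊢
  have hmono' : Monotone fun N => eLpNorm (s N) 2 μ := fun M N hMN =>
    (ENNReal.pow_le_pow_left_iff two_ne_zero).1 (hmono hMN)
  have hsup : eLpNorm f 2 μ = ⨆ N, eLpNorm (s N) 2 μ := by
    refine le_antisymm ?_ (iSup_le fun M => ?_)
    · refine ENNReal.le_of_forall_pos_le_add fun ε hε _ => ?_
      obtain ⟨N, hN⟩ := (hlt ε hε).exists
      calc eLpNorm f 2 μ = eLpNorm (s N + (fun x => f x - s N x)) 2 μ := by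
            congr 1
            ext x
            simp
        _ ≤ eLpNorm (s N) 2 μ + eLpNorm (fun x => f x - s N x) 2 μ :=
            eLpNorm_add_le (hs N) (hf.sub (hs N)) one_le_two
        _ ≤ _ := add_le_add (le_iSup (fun N => eLpNorm (s N) 2 μ) N) hN.le
    · refine ENNReal.le_of_forall_pos_le_add fun ε hε _ => ?_
      obtain ⟨N, hN, hMN⟩ := ((hlt ε hε).and_eventually (eventually_ge_atTop M)).exists
      calc eLpNorm (s M) 2 μ ≤ eLpNorm (s N) 2 μ := hmono' hMN
        _ = eLpNorm (f - (fun x => f x - s N x)) 2 μ := by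
            congr 1
            ext x
            simp
        _ ≤ eLpNorm f 2 μ + eLpNorm (fun x => f x - s N x) 2 μ :=
            eLpNorm_sub_le hf (hf.sub (hs N)) one_le_two
        _ ≤ _ := by gcongr
  have h1 := (ENNReal.continuous_pow 2).continuousAt.tendsto.comp (tendsto_atTop_iSup hmono')
  rw [← hsup] at h1
  exact tendsto_nhds_unique h1 (tendsto_atTop_iSup hmono)

variable {Ω : Type*} [MeasurableSpace Ω] {P : Measure Ω} [IsProbabilityMeasure P]
  {k₀ d L : ℝ} {p : Fin 3 → ℝ} {h : ℝ → Ω → ℂ}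
  {W : (((ℝ × ℝ) × (ℝ × ℝ)) → ℂ) → Ω → ℂ}

instance isFiniteMeasure_restrict_aperture (d L : ℝ) :
    IsFiniteMeasure (volume.restrict (aperture d L)) :=
  inferInstanceAs (IsFiniteMeasure (volume.restrict (Set.Icc (d / 2) (d / 2 + L))))

lemma IsChannelField.ae_aestronglyMeasurable (hh : IsChannelField P k₀ d L p W h) :
    ∀ᵐ ω ∂P, AEStronglyMeasurable (fun z => h z ω) (volume.restrict (aperture d L)) :=
  hh.aemeasurable.aestronglyMeasurable.prodMk_right

lemma IsChannelField.ae_lintegral_lt_top (hk : 0 < k₀)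
    (hW : IsComplexWhiteNoise P (waveMeasure k₀) W) (hh : IsChannelField P k₀ d L p W h) :
    ∀ᵐ ω ∂P, ∫⁻ z in aperture d L, ‖h z ω‖ₑ ^ 2 < ∞ := by
  have hm : AEMeasurable (fun x : ℝ × Ω => ‖h x.1 x.2‖ₑ ^ 2)
      ((volume.restrict (aperture d L)).prod P) := hh.aemeasurable.enorm.pow_const 2
  refine ae_lt_top' hm.prod_swap.lintegral_prod_right' ?_
  have h1 := lintegral_lintegral_swap (f := fun z ω => ‖h z ω‖ₑ ^ 2) hm
  have h2 : ∫⁻ z in aperture d L, ∫⁻ ω, ‖h z ω‖ₑ ^ 2 ∂P = volume (aperture d L) := by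
    rw [setLIntegral_congr_fun (s := aperture d L) (g := fun _ => 1) measurableSet_Icc
      fun z hz => hh.lintegral_enorm_sq hk hW hz]
    simp
  rw [h1.symm.trans h2]
  exact measure_Icc_lt_top.ne

theorem IsChannelField.ae_integrableOn (hk : 0 < k₀)
    (hW : IsComplexWhiteNoise P (waveMeasure k₀) W) (hh : IsChannelField P k₀ d L p W h) :
    ∀ᵐ ω ∂P, IntegrableOn (fun z => ‖h z ω‖ ^ 2) (aperture d L) := by
  filter_upwards [hh.ae_aestronglyMeasurable, hh.ae_lintegral_lt_top hk hW] with ω h1 h2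
  refine ⟨h1.norm.pow 2, ?_⟩
  rw [hasFiniteIntegral_iff_enorm]
  simpa using h2

lemma IsChannelField.channelGain_ae_eq (hh : IsChannelField P k₀ d L p W h) :
    channelGain (aperture d L) h
      =ᵐ[P] fun ω => (∫⁻ z in aperture d L, ‖h z ω‖ₑ ^ 2).toReal := by
  filter_upwards [hh.ae_aestronglyMeasurable] with ω h1
  rw [channelGain, integral_eq_lintegral_of_nonneg_ae (Eventually.of_forall fun z => by positivity)
    (by exact h1.norm.pow 2)]
  congr 1
  refine lintegral_congr fun z => ?_
  rw [ENNReal.ofReal_pow (norm_nonneg _), ofReal_norm]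

/-- The Karhunen–Loève expansion converges in `L²(P)` at each point, boundedly over the aperture, so
it converges in `L²` of the product; by Fatou's lemma the random `L²(aperture)` distances have lower
limit `0` almost surely. -/
theorem IsChannelField.ae_lintegral_eq_tsum
    (hh : IsChannelField P k₀ d L p W h) {lam : ℕ → ℝ} {phi : ℕ → ℝ → ℂ}
    (hE : IsEigensystem (sincKernel k₀) (aperture d L) lam phi) (hlam : ∀ n, 0 ≤ lam n)
    {Psi : ℕ → Ω → ℂ} (hPsi : ∀ n, AEMeasurable (Psi n) P)
    (hlim : ∀ z ∈ aperture d L, Tendsto (fun N => eLpNorm (fun ω =>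
      h z ω - klPartialSum lam phi Psi N z ω) 2 P) atTop (𝓝 0))
    (hle : ∀ z ∈ aperture d L, ∀ N, eLpNorm (fun ω =>
      h z ω - klPartialSum lam phi Psi N z ω) 2 P ≤ 1) :
    ∀ᵐ ω ∂P, ∫⁻ z in aperture d L, ‖h z ω‖ₑ ^ 2
      = ∑' n, ENNReal.ofReal (lam n * ‖Psi n ω‖ ^ 2) := by
  set μ := volume.restrict (aperture d L) with hμ
  have hm : ∀ N, AEMeasurable (fun x : ℝ × Ω =>
      ‖h x.1 x.2 - klPartialSum lam phi Psi N x.1 x.2‖ₑ ^ 2) (μ.prod P) := by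
    intro N
    refine (hh.aemeasurable.sub ?_).enorm.pow_const 2
    refine Finset.aemeasurable_fun_sum _ fun n _ => ?_
    exact ((hE.memLp n).1.aemeasurable.comp_fst.const_mul _).mul (hPsi n).comp_snd
  have hD : ∀ N, AEMeasurable (fun ω => ∫⁻ z, ‖h z ω - klPartialSum lam phi Psi N z ω‖ₑ ^ 2 ∂μ) P :=
    fun N => (hm N).prod_swap.lintegral_prod_right'
  have hint : Tendsto (fun N => ∫⁻ ω, ∫⁻ z, ‖h z ω - klPartialSum lam phi Psi N z ω‖ₑ ^ 2 ∂μ ∂P)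
      atTop (𝓝 0) := by
    have h1 : Tendsto (fun N => ∫⁻ z, ∫⁻ ω, ‖h z ω - klPartialSum lam phi Psi N z ω‖ₑ ^ 2 ∂P ∂μ)
        atTop (𝓝 (∫⁻ _, 0 ∂μ)) := by
      refine tendsto_lintegral_of_dominated_convergence' (fun _ => 1)
        (fun N => (hm N).lintegral_prod_right') (fun N => ?_) (by simp) ?_
      · filter_upwards [self_mem_ae_restrict (measurableSet_Icc (a := d / 2) (b := d / 2 + L))]
          with z hz
        rw [← eLpNorm_two_sq]
        exact pow_le_one₀ (by positivity) (hle z hz N)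
      · filter_upwards [self_mem_ae_restrict (measurableSet_Icc (a := d / 2) (b := d / 2 + L))]
          with z hz
        simp only [← eLpNorm_two_sq]
        simpa [Function.comp_def] using
          (ENNReal.continuous_pow 2).continuousAt.tendsto.comp (hlim z hz)
    rw [lintegral_zero] at h1
    exact h1.congr fun N => lintegral_lintegral_swap
      (f := fun z ω => ‖h z ω - klPartialSum lam phi Psi N z ω‖ₑ ^ 2) (hm N)
  have hliminf : ∀ᵐ ω ∂P, liminf (fun N =>
      ∫⁻ z, ‖h z ω - klPartialSum lam phi Psi N z ω‖ₑ ^ 2 ∂μ) atTop = 0 := by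
    have h1 := lintegral_liminf_le' (u := atTop) hD
    have h2 : AEMeasurable (fun ω => liminf (fun N =>
        ∫⁻ z, ‖h z ω - klPartialSum lam phi Psi N z ω‖ₑ ^ 2 ∂μ) atTop) P := by
      refine ⟨_, Measurable.liminf fun N => (hD N).measurable_mk, ?_⟩
      filter_upwards [ae_all_iff.2 fun N => (hD N).ae_eq_mk] with ω hω
      simp only [← hω]
    rw [hint.liminf_eq, nonpos_iff_eq_zero, lintegral_eq_zero_iff' h2] at h1
    exact h1
  filter_upwards [hliminf, hh.ae_aestronglyMeasurable] with ω h1 h2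
  have h3 := lintegral_enorm_sq_eq_iSup h2 (s := fun N z => klPartialSum lam phi Psi N z ω)
    (fun N => ?_) ?_ h1
  · rw [h3, ENNReal.tsum_eq_iSup_nat]
    simp only [hE.lintegral_klPartialSum_sq hlam]
  · refine Finset.aestronglyMeasurable_fun_sum _ fun n _ => ?_
    exact ((hE.memLp n).1.const_mul _).mul_const _
  · simp only [hE.lintegral_klPartialSum_sq hlam]
    exact fun M N hMN => Finset.sum_le_sum_of_subset (Finset.range_mono hMN)

end Gain

/-! ### Transfer to an arbitrary Gaussian sequence -/

section

variable {Ω Ω' : Type*} [MeasurableSpace Ω] [MeasurableSpace Ω'] {P : Measure Ω} {P' : Measure Ω'}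
  {Psi : ℕ → Ω → ℂ} {Psi' : ℕ → Ω' → ℂ}

lemma IsIIDComplexGaussian.identDistrib (h : IsIIDComplexGaussian P Psi)
    (h' : IsIIDComplexGaussian P' Psi') :
    IdentDistrib (fun ω n => Psi n ω) (fun ω n => Psi' n ω) P P' :=
  IdentDistrib.pi (fun n => (h.1 n).identDistrib (h'.1 n)) h.2 h'.2

lemma IsIIDComplexGaussian.iIndepFun_norm_sq (h : IsIIDComplexGaussian P Psi) :
    iIndepFun (fun n ω => ‖Psi n ω‖ ^ 2) P :=
  h.2.comp (fun _ z => ‖z‖ ^ 2) fun _ => by fun_prop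

lemma measurable_klPartialSum (lam : ℕ → ℝ) (phi : ℕ → ℝ → ℂ) (N : ℕ) (z : ℝ) :
    Measurable fun x : ℕ → ℂ => klPartialSum lam phi (fun n x => x n) N z x := by
  unfold klPartialSum
  fun_prop

/-- The mean-square sum of the series is a measurable function of the coefficient sequence, and the
same function of another sequence with the same law has the same finite-dimensional
distributions. -/
theorem hasKLExpansion_of_isIIDComplexGaussian {S : Set ℝ} {h : ℝ → Ω → ℂ} {lam : ℕ → ℝ}
    {phi : ℕ → ℝ → ℂ} (hPsi : IsIIDComplexGaussian P Psi) (hPsi' : IsIIDComplexGaussian P' Psi')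
    (hh : ∀ z ∈ S, MemLp (h z) 2 P)
    (hlim : ∀ z ∈ S, Tendsto (fun N => eLpNorm (fun ω =>
      h z ω - klPartialSum lam phi Psi N z ω) 2 P) atTop (𝓝 0)) :
    HasKLExpansion P P' S h lam phi Psi' := by
  have hT := hPsi.identDistrib hPsi'
  choose H hH hHh using fun z : S => exists_measurable_comp_ae_eq hT.aemeasurable_fst
    (fun N => measurable_klPartialSum lam phi N z) (hh z z.2).1 (hlim z z.2)
  refine ⟨fun z ω => H z fun n => Psi' n ω, fun z => ⟨?_, ?_⟩, fun I => ?_⟩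
  · exact (hT.comp (hH z)).memLp_snd ((memLp_congr_ae (hHh z)).1 (hh z z.2))
  · refine (hlim z z.2).congr fun N => ?_
    have h1 := (hT.comp ((measurable_klPartialSum lam phi N z).sub (hH z))).eLpNorm_eq 2
    refine Eq.trans ?_ h1
    rw [← eLpNorm_neg]
    refine eLpNorm_congr_ae ?_
    filter_upwards [hHh z] with ω hω
    simp only [Pi.neg_apply, neg_sub, hω]
    rfl
  · have h1 := hT.comp (u := fun x (z : I) => H z.1 x) (measurable_pi_lambda _ fun z => hH z.1)
    refine IdentDistrib.trans (IdentDistrib.symm (IdentDistrib.of_ae_eq h1.aemeasurable_fst ?_)) h1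
    filter_upwards [ae_all_iff.2 fun z : I => hHh z.1] with ω hω
    ext z
    exact (hω z).symm

/-- Almost sure convergence and the law of the weighted exponential series depend only on the law of
the Gaussian sequence. The sum is formed in `[0, ∞]`, where it is measurable without any
summability. -/
lemma ae_summable_and_identDistrib {G : Ω → ℝ≥0∞} {lam : ℕ → ℝ} (hlam : ∀ n, 0 ≤ lam n)
    (hPsi : IsIIDComplexGaussian P Psi) (hPsi' : IsIIDComplexGaussian P' Psi')
    (hG : ∀ᵐ ω ∂P, G ω = ∑' n, ENNReal.ofReal (lam n * ‖Psi n ω‖ ^ 2))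
    (hfin : ∀ᵐ ω ∂P, G ω < ∞) :
    (∀ᵐ ω ∂P', Summable fun n => lam n * ‖Psi' n ω‖ ^ 2) ∧
      IdentDistrib (fun ω => (G ω).toReal) (fun ω => ∑' n, lam n * ‖Psi' n ω‖ ^ 2) P P' := by
  have hT := hPsi.identDistrib hPsi'
  set F : (ℕ → ℂ) → ℝ≥0∞ := fun x => ∑' n, ENNReal.ofReal (lam n * ‖x n‖ ^ 2) with hF
  have hFm : Measurable F := Measurable.tsum fun n => by fun_prop
  have hFT := hT.comp hFm
  have hfin' : ∀ᵐ ω ∂P', F (fun n => Psi' n ω) < ∞ := by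
    refine hFT.ae_snd measurableSet_Iio ?_
    filter_upwards [hG, hfin] with ω h1 h2
    rwa [h1] at h2
  have htoReal : ∀ x : ℕ → ℂ, (F x).toReal = ∑' n, lam n * ‖x n‖ ^ 2 := fun x => by
    rw [ENNReal.tsum_toReal_eq fun _ => ENNReal.ofReal_ne_top]
    exact tsum_congr fun n => ENNReal.toReal_ofReal (mul_nonneg (hlam n) (by positivity))
  constructor
  · filter_upwards [hfin'] with ω hω
    refine (ENNReal.summable_toReal hω.ne).congr fun n => ?_
    exact ENNReal.toReal_ofReal (mul_nonneg (hlam n) (by positivity))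
  · have h1 := hFT.comp ENNReal.measurable_toReal
    refine IdentDistrib.trans (IdentDistrib.symm (IdentDistrib.of_ae_eq h1.aemeasurable_fst ?_))
      (h1.trans (IdentDistrib.of_ae_eq h1.aemeasurable_snd ?_))
    · filter_upwards [hG] with ω hω
      simp only [Function.comp_apply, hω, hF]
    · exact Eventually.of_forall fun ω => htoReal _

end

theorem corollary1 {Ω : Type*} [MeasurableSpace Ω] (P : Measure Ω) [IsProbabilityMeasure P]
    (k₀ d L : ℝ) (hk₀ : 0 < k₀) (hL : 0 < L) (p : Fin 3 → ℝ)
    (W : (((ℝ × ℝ) × (ℝ × ℝ)) → ℂ) → Ω → ℂ) (hW : IsComplexWhiteNoise P (waveMeasure k₀) W)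
    (h : ℝ → Ω → ℂ) (hh : IsChannelField P k₀ d L p W h) :
    -- the field is zero-mean complex Gaussian with the sinc autocorrelation
    IsCircularGaussianField P (fun z : aperture d L => h z)
      (fun z z' => sincKernel k₀ z z') ∧
    -- the gain is almost surely an honest finite integral
    (∀ᵐ ω ∂P, IntegrableOn (fun z => ‖h z ω‖ ^ 2) (aperture d L)) ∧
    -- the eigendecomposition exists
    (∃ (lam : ℕ → ℝ) (phi : ℕ → ℝ → ℂ),
      IsEigensystem (sincKernel k₀) (aperture d L) lam phi) ∧
    -- and whichever one is chosen:
    ∀ (lam : ℕ → ℝ) (phi : ℕ → ℝ → ℂ),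
      IsEigensystem (sincKernel k₀) (aperture d L) lam phi →
      (∀ n, 0 < lam n) ∧
      (∀ z ∈ aperture d L, ∀ z' ∈ aperture d L,
        HasSum (fun n => (lam n : ℂ) * phi n z * conj (phi n z')) (sincKernel k₀ z z')) ∧
      ∀ {Ω' : Type*} [MeasurableSpace Ω'] (P' : Measure Ω') [IsProbabilityMeasure P']
        (Psi : ℕ → Ω' → ℂ), IsIIDComplexGaussian P' Psi →
        HasKLExpansion P P' (aperture d L) h lam phi Psi ∧
        (∀ᵐ ω ∂P', Summable (fun n => lam n * ‖Psi n ω‖ ^ 2)) ∧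
        IdentDistrib (channelGain (aperture d L) h)
          (fun ω => ∑' n, lam n * ‖Psi n ω‖ ^ 2) P P' ∧
        (∀ n, HasLaw (fun ω => ‖Psi n ω‖ ^ 2) (expMeasure 1) P') ∧
        iIndepFun (fun n ω => ‖Psi n ω‖ ^ 2) P' := by
  have hab : d / 2 < d / 2 + L := by linarith
  have hfield := hh.isCircularGaussianField hk₀ hW
  refine ⟨hfield, hh.ae_integrableOn hk₀ hW, exists_isEigensystem_sincKernel hk₀ hab,
    fun lam phi hE => ?_⟩
  have hpos : ∀ n, 0 < lam n := (hE.exists_hilbertBasis hk₀ hab).1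
  refine ⟨hpos, fun z hz z' hz' => hE.hasSum_sincKernel hk₀ hab hz hz', ?_⟩
  intro Ω' _ P' _ Psi' hPsi'
  obtain ⟨Psi, hPsi, hlim⟩ := hh.exists_isIIDComplexGaussian hk₀ hL hW hE
  have hgain := hh.ae_lintegral_eq_tsum hE (fun n => (hpos n).le) (fun n => (hPsi.1 n).aemeasurable)
    (fun z hz => (hlim z hz).1) (fun z hz => (hlim z hz).2)
  obtain ⟨hsum, hident⟩ := ae_summable_and_identDistrib (fun n => (hpos n).le) hPsi hPsi' hgain
    (hh.ae_lintegral_lt_top hk₀ hW)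
  have hgm : IdentDistrib (channelGain (aperture d L) h)
      (fun ω => (∫⁻ z in aperture d L, ‖h z ω‖ₑ ^ 2).toReal) P P :=
    (IdentDistrib.of_ae_eq hident.aemeasurable_fst hh.channelGain_ae_eq.symm).symm
  exact ⟨hasKLExpansion_of_isIIDComplexGaussian hPsi hPsi'
      (fun z hz => hfield.memLp_two ⟨z, hz⟩) (fun z hz => (hlim z hz).1),
    hsum, hgm.trans hident, fun n => hasLaw_norm_sq_expMeasure (hPsi'.1 n),
    hPsi'.iIndepFun_norm_sq⟩
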